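/- **Conventions.** A function $f:\mathbb N\to\mathbb R$ is negligible, $f=\mathrm{negl}(n)$, if for every $c\in\mathbb N$ one has $|f(n)|<n^{-c}$ for all large $n$. $\sigma_r=I/2^r$ is the maximally mixed state of $r$ qubits, and $\|A\|_1=\mathrm{tr}\sqrt{A^\dagger A}$. A *QPT algorithm* is a family (indexed by $n$) of quantum circuits of gates on at most two qubits, with a polynomially bounded number of qubits and gates, which may start with an arbitrary (advice) state on part of its qubits and outputs the result of measuring one qubit; with oracle access to a unitary $U$, it may also apply $U$ to chosen qubits, each query counting as one gate. Let $N(n),\kappa(n)$ be functions $\mathbb N\to\mathbb N$. Unitaries $V_{n,k}$ on $N(n)$ qubits, with keys $k\in\{0,1\}^{\kappa(n)}$, are *pseudorandom unitaries* (PRU) if $\kappa$ is polynomially bounded; circuits of polynomial size compute $V_{n,k}|\psi\rangle$ from $k$ and $|\psi\rangle$; and for every QPT oracle algorithm $\mathcal A$ $$\Big|\Pr_{k}[\mathcal A^{V_{n,k}}=1]-\Pr_{U\leftarrow\mathrm{Haar}}[\mathcal A^{U}=1]\Big|=\mathrm{negl}(n).$$ For a unitary $U$ on $z=n+\ell+m$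 qubits and an $n$-qubit state $\rho$ let $$\Phi_U(\rho)=U\big(\rho\otimes|0\rangle\langle 0|^{\otimes\ell}\otimes\sigma_m\big)U^\dagger .$$ **Theorem.** 1. (Haar twirl.) There is a constant $C$ such that for all $n,\ell,m,t,q\in\mathbb N$ and every state $\rho_g$ of $t(n+q)$ qubits, $$\Big\|\int \big(\Phi_U^{\otimes t}\otimes\mathcal I_{qt}\big)(\rho_g)\,dU-\sigma_z^{\otimes t}\otimes\mathrm{tr}_{nt}(\rho_g)\Big\|_1\le C\,\frac{t^2}{2^m},\qquad z=n+\ell+m,$$ where $dU$ is the Haar probability measure on the unitaries of $z$ qubits, $\mathcal I_{qt}$ is the identity channel on $qt$ qubits, and $\mathrm{tr}_{nt}$ is the partial trace over the $nt$ qubits on which $\Phi_U^{\otimes t}$ acts. 2. (Semantic security.) Let $\ell=\ell(n)$, $m=m(n)=\omega(\log n)$, $z=n+\ell+m$, and let $t=t(n)$ be polynomially bounded. Let $U_k=V^{(1)}_{k_1}V^{(2)}_{k_2}V^{(3)}_{k_3}$ for a uniformly random key $k=(k_1,k_2,k_3)$ of three bit strings, where $V^{(1)}$ is a family of pseudorandom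 unitaries on $z$ qubits, and $V^{(2)},V^{(3)}$ are arbitrary keyed families of unitaries on $z$ qubits (in the pseudorandom quantum authentication scheme, PQAS: an approximate 4-design and an exact 2-design). Let $\Phi_k=\Phi_{U_k}$. Then for every $q=q(n)$, all states $\rho_g=\rho_g(n)$ of $t(n+q)$ qubits, and every QPT algorithm $\mathcal A$, $$\Big|\Pr_{k}\big[\mathcal A\big((\Phi_k^{\otimes t}\otimes\mathcal I_{qt})(\rho_g)\big)=1\big]-\Pr\big[\mathcal A\big(\sigma_z^{\otimes t}\otimes\mathrm{tr}_{nt}(\rho_g)\big)=1\big]\Big|=\mathrm{negl}(n).$$ In particular, for all $n$-qubit states $\rho=\rho(n)$ and every QPT algorithm $\mathcal A$, $$\Big|\Pr_{k}\big[\mathcal A\big(\Phi_k(\rho)^{\otimes t}\big)=1\big]-\Pr\big[\mathcal A\big(\sigma_z^{\otimes t}\big)=1\big]\Big|=\mathrm{negl}(n).$$ -/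

import Mathlib

open scoped MatrixOrder ComplexOrder

namespace QCrypto

/-! Registers of qubits, operators and states -/

/-- The computational basis of a register whose qubits are labelled by `ι`. -/
abbrev Conf (ι : Type) : Type := ι → Bool

/-- Operators on the Hilbert space `(ℂ²)^{⊗ι}` of that register, as matrices in the
computational basis. -/
abbrev Op (ι : Type) : Type := Matrix (Conf ι) (Conf ι) ℂ

/-- The unitary group of the register labelled by `ι`. -/
abbrev UGroup (ι : Type) [Fintype ι] [DecidableEq ι] : Type := Matrix.unitaryGroup (Conf ι) ℂ

/-- Density operators (quantum states). -/
def IsDensity {ι : Type} [Fintype ι] [DecidableEq ι] (ρ : Op ι) : Prop :=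
  ρ.PosSemidef ∧ ρ.trace = 1

/-- Tensor product of two operators. -/
noncomputable def tensor {ι κ : Type} (A : Op ι) (B : Op κ) : Op (ι ⊕ κ) :=
  fun x y => A (x ∘ Sum.inl) (y ∘ Sum.inl) * B (x ∘ Sum.inr) (y ∘ Sum.inr)

/-- Tensor power `A^{⊗t}`; the qubit `i` of the `j`-th copy has the label `(j, i)`. -/
noncomputable def tensorPow {ι : Type} (t : ℕ) (A : Op ι) : Op (Fin t × ι) :=
  fun x y => ∏ j : Fin t, A (fun i => x (j, i)) (fun i => y (j, i))

/-- Renaming the qubits of a register. -/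
def relabel {ι κ : Type} (e : ι ≃ κ) (A : Op ι) : Op κ :=
  fun x y => A (x ∘ e) (y ∘ e)

/-- Partial trace over the first of two registers. -/
noncomputable def traceLeft {ι κ : Type} [Fintype ι] [DecidableEq ι] (ρ : Op (ι ⊕ κ)) : Op κ :=
  fun x y => ∑ a : Conf ι, ρ (Sum.elim a x) (Sum.elim a y)

/-- Partial trace over the second of two registers. -/
noncomputable def traceRight {ι κ : Type} [Fintype κ] [DecidableEq κ] (ρ : Op (ι ⊕ κ)) : Op ι :=
  fun x y => ∑ b : Conf κ, ρ (Sum.elim x b) (Sum.elim y b)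

/-- The maximally mixed state `σ = I / 2^{#ι}`. -/
noncomputable def maxMixed (ι : Type) [Fintype ι] [DecidableEq ι] : Op ι :=
  ((2 : ℂ) ^ Fintype.card ι)⁻¹ • (1 : Op ι)

/-- The computational basis state `|s⟩⟨s|`. -/
noncomputable def basisState {ι : Type} [Fintype ι] [DecidableEq ι] (s : Conf ι) : Op ι :=
  Matrix.single s s 1

/-- The state `|0⟩⟨0|` of all qubits of the register. -/
noncomputable def zeroState (ι : Type) [Fintype ι] [DecidableEq ι] : Op ι :=
  basisState fun _ => false

/-- The trace norm `‖A‖₁ = tr √(A† A)`. -/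
noncomputable def traceNorm {ι : Type} [Fintype ι] [DecidableEq ι] (A : Op ι) : ℝ :=
  (CFC.sqrt (A.conjTranspose * A)).trace.re

/-- The action on `ρ` of `Φ^{⊗t} ⊗ id`, where `Φ` is a linear map from operators on `ι` to
operators on `ι'`, and `id` is the identity channel on the register `κ`. (Expand the first
part of `ρ` in matrix units, and apply `Φ` to each of the `t` factors of a unit.) -/
noncomputable def parallel {ι ι' κ : Type} [Fintype ι] [DecidableEq ι] (t : ℕ)
    (Φ : Op ι →ₗ[ℂ] Op ι') (ρ : Op ((Fin t × ι) ⊕ κ)) : Op ((Fin t × ι') ⊕ κ) :=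
  fun x y => ∑ a : Fin t → Conf ι, ∑ b : Fin t → Conf ι,
    (∏ j : Fin t, Φ (Matrix.single (a j) (b j) 1)
      (fun i => x (Sum.inl (j, i))) (fun i => y (Sum.inl (j, i)))) *
    ρ (Sum.elim (fun p => a p.1 p.2) (x ∘ Sum.inr)) (Sum.elim (fun p => b p.1 p.2) (y ∘ Sum.inr))

/-! The Haar probability measure -/

/-- The Borel sets of the unitary group. -/
noncomputable instance instMeasurableSpaceUGroup (ι : Type) [Fintype ι] [DecidableEq ι] :
    MeasurableSpace (UGroup ι) := borel _

instance instBorelSpaceUGroup (ι : Type) [Fintype ι] [DecidableEq ι] :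
    BorelSpace (UGroup ι) := ⟨rfl⟩

instance instCompactSpaceUGroup (ι : Type) [Fintype ι] [DecidableEq ι] :
    CompactSpace (UGroup ι) := by
  refine isCompact_iff_compactSpace.1 ?_
  have hs : IsCompact (X := Op ι) (Set.univ.pi fun _ : Conf ι => Set.univ.pi fun _ : Conf ι =>
      Metric.closedBall (0 : ℂ) 1) :=
    isCompact_univ_pi fun _ => isCompact_univ_pi fun _ => isCompact_closedBall _ _
  refine IsCompact.of_isClosed_subset hs ?_ ?_
  · have h : ((Matrix.unitaryGroup (Conf ι) ℂ : Submonoid (Op ι)) : Set (Op ι)) =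
        {A | star A * A = 1} ∩ {A | A * star A = 1} := by
      ext A
      exact Unitary.mem_iff
    rw [h]
    exact (isClosed_eq (by fun_prop) continuous_const).inter
      (isClosed_eq (by fun_prop) continuous_const)
  · intro A hA
    refine fun i _ j _ => mem_closedBall_zero_iff.2 ?_
    exact entry_norm_bound_of_unitary hA i j

/-- The Haar probability measure on the unitary group of a register. -/
noncomputable def haarU (ι : Type) [Fintype ι] [DecidableEq ι] : MeasureTheory.Measure (UGroup ι) :=
  MeasureTheory.Measure.haarMeasure ⊤

/-! Asymptotics -/

/-- Negligible functions, that is `|f n| < n^{-c}` for each `c` and all large `n`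
(see `negligible_iff`). -/
def Negligible (f : ℕ → ℝ) : Prop :=
  Asymptotics.SuperpolynomialDecay Filter.atTop (fun n : ℕ => (n : ℝ)) f

theorem negligible_iff (f : ℕ → ℝ) :
    Negligible f ↔ ∀ c : ℕ, ∃ n₀ : ℕ, ∀ n > n₀, |f n| < ((n : ℝ) ^ c)⁻¹ := by
  constructor
  · intro h c
    obtain ⟨n₀, hn⟩ := Filter.eventually_atTop.1 (((tendsto_zero_iff_abs_tendsto_zero _).1
      (h c)).eventually (gt_mem_nhds zero_lt_one))
    refine ⟨n₀, fun n hn' => ?_⟩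
    have hpos : (0 : ℝ) < (n : ℝ) ^ c := pow_pos (by exact_mod_cast (by omega)) c
    have h2 := hn n hn'.le
    simp only [Function.comp_apply, abs_mul, abs_of_pos hpos] at h2
    rw [inv_eq_one_div, lt_div_iff₀ hpos]
    linarith
  · intro h c
    rw [tendsto_zero_iff_abs_tendsto_zero]
    obtain ⟨n₀, hn⟩ := h (c + 1)
    refine squeeze_zero' (Filter.Eventually.of_forall fun n => abs_nonneg _) ?_
      (tendsto_inv_atTop_nhds_zero_nat (𝕜 := ℝ))
    filter_upwards [Filter.eventually_gt_atTop n₀] with n hn'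
    have hn0 : (0 : ℝ) < n := by exact_mod_cast (by omega)
    have h2 := (hn n hn').le
    simp only [Function.comp_apply, abs_mul, abs_of_pos (pow_pos hn0 c)]
    calc (n : ℝ) ^ c * |f n| ≤ (n : ℝ) ^ c * ((n : ℝ) ^ (c + 1))⁻¹ := by gcongr
      _ = (n : ℝ)⁻¹ := by field_simp; ring

/-- Functions bounded by a polynomial. -/
def PolyBounded (f : ℕ → ℕ) : Prop :=
  ∃ c : ℕ, ∀ n, f n ≤ n ^ c + c

/-- The average over a uniformly random element of a finite set (of keys). -/
noncomputable def uniformAvg {K : Type} [Fintype K] (f : K → ℝ) : ℝ :=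
  (∑ k, f k) / Fintype.card K

/-! Quantum circuits -/

open Classical in
/-- The operator `u`, acting on the qubits `f i` of the register `ι` and as the identity on all
other qubits. -/
noncomputable def actOn {ι κ : Type} (f : κ ↪ ι) (u : Op κ) : Op ι :=
  fun x y => if ∀ i, i ∉ Set.range f → x i = y i then u (x ∘ f) (y ∘ f) else 0

/-- An elementary gate: a unitary on at most two qubits of the register. -/
structure Gate (ι : Type) where
  arity : ℕ
  arity_le : arity ≤ 2
  wires : Fin arity ↪ ι
  unitary : UGroup (Fin arity)

/-- The unitary operator that a gate applies to the register. -/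
noncomputable def Gate.op {ι : Type} (g : Gate ι) : Op ι :=
  actOn g.wires (g.unitary : Op (Fin g.arity))

/-- The operator of a circuit; the head of the list is applied first. -/
noncomputable def circuitOp {ι : Type} [Fintype ι] [DecidableEq ι] : List (Gate ι) → Op ι
  | [] => 1
  | g :: C => circuitOp C * g.op

/-- The operator of a circuit which may query an oracle for the `N`-qubit unitary `U`. An
instruction is a gate or a query, which applies `U` to `N` chosen qubits of the register. -/
noncomputable def oracleCircuitOp {ι : Type} [Fintype ι] [DecidableEq ι] {N : ℕ}
    (U : UGroup (Fin N)) : List (Gate ι ⊕ (Fin N ↪ ι)) → Op ι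
  | [] => 1
  | Sum.inl g :: C => oracleCircuitOp U C * g.op
  | Sum.inr f :: C => oracleCircuitOp U C * actOn f (U : Op (Fin N))

/-- The probability that a measurement of the qubit `i` in the computational basis gives `1`. -/
noncomputable def probOne {ι : Type} [Fintype ι] [DecidableEq ι] (i : ι) (ρ : Op ι) : ℝ :=
  ∑ x : Conf ι, if x i = true then (ρ x x).re else 0

/-- A quantum algorithm with a one-bit output, for an input state on the register `ι`: it holds a
further register with an advice state (work qubits in the state `|0⟩` included), runs a circuit on
both registers and measures one qubit. -/
structure Distinguisher (ι : Type) where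
  work : ℕ
  advice : Op (Fin work)
  advice_isDensity : IsDensity advice
  circuit : List (Gate (ι ⊕ Fin work))
  out : ι ⊕ Fin work

/-- The size of the algorithm: number of its qubits plus number of its gates. -/
def Distinguisher.size {ι : Type} [Fintype ι] (A : Distinguisher ι) : ℕ :=
  Fintype.card ι + A.work + A.circuit.length

/-- `Pr[A(ρ) = 1]`. -/
noncomputable def Distinguisher.prob {ι : Type} [Fintype ι] [DecidableEq ι]
    (A : Distinguisher ι) (ρ : Op ι) : ℝ :=
  probOne A.out
    (circuitOp A.circuit * tensor ρ A.advice * (circuitOp A.circuit).conjTranspose)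

/-- A quantum algorithm with a one-bit output and oracle access to an `N`-qubit unitary, which
starts from an advice state (work qubits in the state `|0⟩` included). -/
structure OracleDistinguisher (N : ℕ) where
  work : ℕ
  advice : Op (Fin work)
  advice_isDensity : IsDensity advice
  circuit : List (Gate (Fin work) ⊕ (Fin N ↪ Fin work))
  out : Fin work

/-- The size of the algorithm: number of its qubits plus number of its gates and queries. -/
def OracleDistinguisher.size {N : ℕ} (A : OracleDistinguisher N) : ℕ :=
  A.work + A.circuit.length

/-- `Pr[A^U = 1]`. -/
noncomputable def OracleDistinguisher.prob {N : ℕ} (A : OracleDistinguisher N)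
    (U : UGroup (Fin N)) : ℝ :=
  probOne A.out
    (oracleCircuitOp U A.circuit * A.advice * (oracleCircuitOp U A.circuit).conjTranspose)

/-! Pseudorandom unitaries -/

/-- The families `{V n k}`, with keys `k ∈ {0,1}^{κ n}`, of unitaries on `N n` qubits are
pseudorandom unitaries: the key length is polynomial, `V n k |ψ⟩` can be computed from `k` and `|ψ⟩`
by circuits of polynomial size, and no polynomial-size quantum algorithm with oracle access
distinguishes `V n k`, for a uniformly random key `k`, from a Haar random unitary. -/
structure IsPRU (N κ : ℕ → ℕ) (V : ∀ n, Conf (Fin (κ n)) → UGroup (Fin (N n))) : Prop where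
  keyLength : PolyBounded κ
  efficient : ∃ (w : ℕ → ℕ) (C : ∀ n, List (Gate (Fin (N n) ⊕ (Fin (κ n) ⊕ Fin (w n))))),
    PolyBounded (fun n => N n + κ n + w n + (C n).length) ∧
    ∀ (n : ℕ) (k : Conf (Fin (κ n))) (ρ : Op (Fin (N n))), IsDensity ρ →
      traceRight (circuitOp (C n) * tensor ρ (tensor (basisState k) (zeroState (Fin (w n)))) *
        (circuitOp (C n)).conjTranspose) =
      (V n k : Op (Fin (N n))) * ρ * (V n k : Op (Fin (N n))).conjTranspose
  pseudorandom : ∀ A : ∀ n, OracleDistinguisher (N n), PolyBounded (fun n => (A n).size) →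
    Negligible fun n =>
      |uniformAvg (fun k => (A n).prob (V n k)) - ∫ U, (A n).prob U ∂haarU (Fin (N n))|

/-! The encryption channel -/

/-- The state `ρ ⊗ |0⟩⟨0| ⊗ σ` with `ℓ` tag qubits and `m` maximally mixed qubits. -/
noncomputable def padState {n : ℕ} (ℓ m : ℕ) (ρ : Op (Fin n)) : Op (Fin (n + ℓ + m)) :=
  relabel ((Equiv.sumCongr finSumFinEquiv (Equiv.refl (Fin m))).trans finSumFinEquiv)
    (tensor (tensor ρ (zeroState (Fin ℓ))) (maxMixed (Fin m)))

/-- The channel `Φ_U(ρ) = U (ρ ⊗ |0⟩⟨0| ⊗ σ) U†`. -/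
noncomputable def encrypt {n ℓ m : ℕ} (U : UGroup (Fin (n + ℓ + m))) :
    Op (Fin n) →ₗ[ℂ] Op (Fin (n + ℓ + m)) where
  toFun ρ := (U : Op (Fin (n + ℓ + m))) * padState ℓ m ρ *
    (U : Op (Fin (n + ℓ + m))).conjTranspose
  map_add' ρ τ := by
    have h : padState ℓ m (ρ + τ) = padState ℓ m ρ + padState ℓ m τ := by
      ext x y
      simp [padState, relabel, tensor, add_mul]
    rw [h, mul_add, add_mul]
  map_smul' c ρ := by
    have h : padState ℓ m (c • ρ) = c • padState ℓ m ρ := by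
      ext x y
      simp [padState, relabel, tensor, mul_assoc]
    rw [h, Matrix.mul_smul, Matrix.smul_mul, RingHom.id_apply]

/-- The scrambling unitary `U_k = V₁ V₂ V₃` of the key `k = (k₁, k₂, k₃)`. -/
def scrambler {κ₁ κ₂ κ₃ N : ℕ} (V₁ : Conf (Fin κ₁) → UGroup (Fin N))
    (V₂ : Conf (Fin κ₂) → UGroup (Fin N)) (V₃ : Conf (Fin κ₃) → UGroup (Fin N))
    (k : Conf (Fin κ₁) × Conf (Fin κ₂) × Conf (Fin κ₃)) : UGroup (Fin N) :=
  V₁ k.1 * V₂ k.2.1 * V₃ k.2.2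

/-- The Haar average `∫ (Φ_U^{⊗t} ⊗ id)(ρ) dU` (entrywise integral). -/
noncomputable def haarEncrypt {n t q : ℕ} (ℓ m : ℕ) (ρ : Op ((Fin t × Fin n) ⊕ (Fin t × Fin q))) :
    Op ((Fin t × Fin (n + ℓ + m)) ⊕ (Fin t × Fin q)) :=
  fun x y => ∫ U, parallel t (encrypt U) ρ x y ∂haarU (Fin (n + ℓ + m))

end QCrypto

open QCrypto

open MeasureTheory

namespace QCrypto

set_option linter.unusedSectionVars false

/-! Trace norm of a difference of positive operators -/

/-! Haar twirl. The `m` mixed qubits are in a uniformly random basis state, so `t` uses of the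
channel are an average, over tuples `s` of `t` strings of length `m`, of conjugations by isometries
that send copy `j` of `|a⟩` to `U |a, 0, s j⟩` (`parallel_encrypt`). If the `s j` are distinct, the
basis states fed into different copies of `U` are always distinct. Invariance of the Haar measure
under sign flips then kills every off-diagonal term (`haarMoment_eq_zero`), and invariance under
permutations of the basis makes all diagonal coefficients equal (`haarMoment_eq_of_injective`). The
twirl is therefore one fixed state `X`, in which the copies are decoupled from the reference
(`haarTwirl_eq_haarTwirlBasis`).

The maximally mixed state has the same form: it is the average over all tuples `u` of basis states
of their Haar twirls (`sum_haarTwirlBasis`), and each injective `u` again gives `X`. The two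
averages thus differ only through tuples with a collision, whose fraction is at most `t² / 2^m` on
either side (`card_not_injective_le`).

Semantic security. Some value of `(k₂, k₃)` is at least as good for the adversary as the average.
For this value, the state encrypted by `W = V₂ V₃` is an advice state, and an oracle algorithm
applies its oracle to the `t` copies and runs the adversary. Pseudorandomness replaces `V₁` by a
Haar unitary `U`, right invariance removes `W` from `U W`, and the twirl estimate finishes
(`negligible_encrypt_of_isPRU`). -/

theorem traceNorm_sub_le {ι : Type} [Fintype ι] [DecidableEq ι] {P Q : Op ι}
    (hP : P.PosSemidef) (hQ : Q.PosSemidef) :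
    traceNorm (P - Q) ≤ P.trace.re + Q.trace.re := by
  set E := P - Q with hE
  have hH : E.IsHermitian := hP.isHermitian.sub hQ.isHermitian
  set V : Op ι := (hH.eigenvectorUnitary : Op ι) with hV
  set d := hH.eigenvalues with hd
  have hVs : V.conjTranspose * V = 1 := Unitary.coe_star_mul_self hH.eigenvectorUnitary
  have hVs' : V * V.conjTranspose = 1 := Unitary.coe_mul_star_self hH.eigenvectorUnitary
  have hspec : E = V * Matrix.diagonal (fun i => (d i : ℂ)) * V.conjTranspose := by
    have := hH.spectral_theorem
    rw [Unitary.conjStarAlgAut_apply] at this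
    exact this
  -- `S` is `|E|`, written in an eigenbasis of `E`. In that basis `d i` is the difference of the
  -- nonnegative diagonal entries of `P` and `Q`, so `|d i|` is at most their sum.
  set S : Op ι := V * Matrix.diagonal (fun i => ((|d i| : ℝ) : ℂ)) * V.conjTranspose with hS
  have hSpos : S.PosSemidef := by
    refine Matrix.PosSemidef.mul_mul_conjTranspose_same ?_ V
    refine Matrix.PosSemidef.diagonal fun i => ?_
    simp
  have hconj : ∀ A B : Op ι, (V * A * V.conjTranspose) * (V * B * V.conjTranspose) =
      V * (A * B) * V.conjTranspose := by
    intro A B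
    calc (V * A * V.conjTranspose) * (V * B * V.conjTranspose)
        = V * A * (V.conjTranspose * V) * B * V.conjTranspose := by simp only [Matrix.mul_assoc]
      _ = _ := by rw [hVs]; simp only [Matrix.mul_assoc, Matrix.one_mul]
  have hSS : S * S = E.conjTranspose * E := by
    rw [hH.eq, hspec, hS, hconj, hconj, Matrix.diagonal_mul_diagonal, Matrix.diagonal_mul_diagonal]
    congr 3
    ext i
    rw [← Complex.ofReal_mul, ← Complex.ofReal_mul, abs_mul_abs_self]
  have hsqrt : CFC.sqrt (E.conjTranspose * E) = S :=
    CFC.sqrt_unique hSS hSpos.nonneg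
  have htr : ∀ A : Op ι, (V.conjTranspose * A * V).trace = A.trace := by
    intro A
    rw [Matrix.trace_mul_cycle, hVs', Matrix.one_mul]
  have hdiag : ∀ i, (d i : ℂ) = (V.conjTranspose * P * V) i i - (V.conjTranspose * Q * V) i i := by
    intro i
    have : V.conjTranspose * E * V = Matrix.diagonal (fun i => (d i : ℂ)) := by
      calc V.conjTranspose * E * V
          = (V.conjTranspose * V) * Matrix.diagonal (fun i => (d i : ℂ)) *
              (V.conjTranspose * V) := by
            rw [hspec]; simp only [Matrix.mul_assoc]
        _ = _ := by rw [hVs, Matrix.one_mul, Matrix.mul_one]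
    rw [← Matrix.sub_apply, ← Matrix.sub_mul, ← Matrix.mul_sub, ← hE, this,
      Matrix.diagonal_apply_eq]
  have hPi : ∀ i, 0 ≤ (V.conjTranspose * P * V) i i :=
    fun i => (hP.conjTranspose_mul_mul_same V).diag_nonneg
  have hQi : ∀ i, 0 ≤ (V.conjTranspose * Q * V) i i :=
    fun i => (hQ.conjTranspose_mul_mul_same V).diag_nonneg
  rw [traceNorm, hsqrt, ← htr S, ← htr P, ← htr Q]
  have h1 : V.conjTranspose * S * V = Matrix.diagonal (fun i => ((|d i| : ℝ) : ℂ)) := by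
    calc V.conjTranspose * S * V
        = (V.conjTranspose * V) * Matrix.diagonal (fun i => ((|d i| : ℝ) : ℂ)) *
            (V.conjTranspose * V) := by
          rw [hS]; simp only [Matrix.mul_assoc]
      _ = _ := by rw [hVs, Matrix.one_mul, Matrix.mul_one]
  rw [h1]
  simp only [Matrix.trace, Matrix.diag_apply, Matrix.diagonal_apply_eq, Complex.re_sum,
    Complex.ofReal_re, ← Finset.sum_add_distrib]
  refine Finset.sum_le_sum fun i _ => ?_
  have h2 := congrArg Complex.re (hdiag i)
  simp only [Complex.ofReal_re, Complex.sub_re] at h2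
  have h3 := (Complex.le_def.1 (hPi i)).1
  have h4 := (Complex.le_def.1 (hQi i)).1
  simp only [Complex.zero_re] at h3 h4
  rw [h2]
  exact abs_le.2 ⟨by linarith, by linarith⟩

/-! Haar averages -/

section Haar

variable {ι : Type} [Fintype ι] [DecidableEq ι]

instance isHaarMeasure_haarU : (haarU ι).IsHaarMeasure := by unfold haarU; infer_instance

instance isProbabilityMeasure_haarU : IsProbabilityMeasure (haarU ι) :=
  ⟨by simpa [haarU] using Measure.haarMeasure_self (G := UGroup ι) (K₀ := ⊤)⟩

/-- A right translate of the Haar measure is still left invariant, hence a multiple of it by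
uniqueness; the total mass 1 forces the factor 1. -/
instance isMulRightInvariant_haarU : (haarU ι).IsMulRightInvariant := by
  refine ⟨fun g => ?_⟩
  have hm : Measurable fun x : UGroup ι => x * g := measurable_mul_const g
  have : IsProbabilityMeasure (Measure.map (fun x : UGroup ι => x * g) (haarU ι)) :=
    Measure.isProbabilityMeasure_map hm.aemeasurable
  have h := Measure.isMulInvariant_eq_smul_of_compactSpace
    (Measure.map (fun x : UGroup ι => x * g) (haarU ι)) (haarU ι)
  have h1 := congrArg (fun μ : Measure (UGroup ι) => μ Set.univ) h
  simp only [measure_univ, Measure.smul_apply] at h1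
  rw [ENNReal.smul_def, smul_eq_mul, mul_one] at h1
  rw [h]
  have h2 : Measure.haarScalarFactor (Measure.map (fun x : UGroup ι => x * g) (haarU ι))
      (haarU ι) = 1 := by exact_mod_cast h1.symm
  rw [h2, one_smul]

theorem integrable_haarU {E : Type} [NormedAddCommGroup E] [SecondCountableTopology E]
    {f : UGroup ι → E} (hf : Continuous f) : Integrable f (haarU ι) := by
  borelize E
  exact hf.integrable_of_hasCompactSupport (HasCompactSupport.of_compactSpace f)

/-- Entrywise Haar average of an operator-valued function. -/
noncomputable def haarMean {α : Type} (F : UGroup ι → Matrix α α ℂ) : Matrix α α ℂ :=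
  fun x y => ∫ U, F U x y ∂haarU ι

theorem posSemidef_haarMean {α : Type} [Fintype α] {F : UGroup ι → Matrix α α ℂ}
    (hc : Continuous F) (hF : ∀ U, (F U).PosSemidef) : (haarMean F).PosSemidef := by
  have hc' : ∀ x y, Continuous fun U => F U x y := fun x y => by fun_prop
  refine Matrix.PosSemidef.of_dotProduct_mulVec_nonneg ?_ fun v => ?_
  · ext x y
    rw [Matrix.conjTranspose_apply, haarMean, haarMean]
    rw [← starRingEnd_apply, ← integral_conj]
    congr 1
    ext U
    exact (hF U).isHermitian.apply x y
  · have : star v ⬝ᵥ (haarMean F).mulVec v = ∫ U, star v ⬝ᵥ (F U).mulVec v ∂haarU ι := by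
      simp only [dotProduct, Matrix.mulVec, haarMean]
      rw [integral_finsetSum _ fun i _ => integrable_haarU (by fun_prop)]
      refine Finset.sum_congr rfl fun i _ => ?_
      rw [integral_const_mul, integral_finsetSum _ fun i _ => integrable_haarU (by fun_prop)]
      simp only [integral_mul_const]
    rw [this]
    exact integral_nonneg fun U => (hF U).dotProduct_mulVec_nonneg v

theorem trace_haarMean {α : Type} [Fintype α] {F : UGroup ι → Matrix α α ℂ}
    (hc : Continuous F) : (haarMean F).trace = ∫ U, (F U).trace ∂haarU ι := by
  have hc' : ∀ x y, Continuous fun U => F U x y := fun x y => by fun_prop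
  simp only [Matrix.trace, Matrix.diag_apply, haarMean]
  rw [integral_finsetSum _ fun i _ => integrable_haarU (by fun_prop)]

/-! Moments of Haar random unitaries -/

/-- The moment `∫ ∏ⱼ U_{xⱼ uⱼ} conj(U_{yⱼ vⱼ}) dU`, that is, an entry of the Haar twirl of
`|u⟩⟨v|`. -/
noncomputable def haarMoment {t : ℕ} (x y u v : Fin t → Conf ι) : ℂ :=
  ∫ U, ∏ j, ((U : Op ι) (x j) (u j) * star ((U : Op ι) (y j) (v j))) ∂haarU ι

theorem haarMoment_eq_of_right_mul {t : ℕ} (x y u v : Fin t → Conf ι) (W : UGroup ι) :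
    haarMoment x y u v = ∫ U, ∏ j, (((U : Op ι) * (W : Op ι)) (x j) (u j) *
      star (((U : Op ι) * (W : Op ι)) (y j) (v j))) ∂haarU ι :=
  (integral_mul_right_eq_self (μ := haarU ι)
    (fun U : UGroup ι => ∏ j, ((U : Op ι) (x j) (u j) * star ((U : Op ι) (y j) (v j)))) W).symm

/-- The unitary that flips the sign of one basis state. -/
noncomputable def signFlip (b : Conf ι) : UGroup ι :=
  ⟨Matrix.diagonal fun x => if x = b then -1 else 1, by
    rw [Matrix.mem_unitaryGroup_iff, Matrix.star_eq_conjTranspose, Matrix.diagonal_conjTranspose,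
      Matrix.diagonal_mul_diagonal, ← Matrix.diagonal_one]
    congr 1
    ext x
    by_cases h : x = b <;> simp [h]⟩

/-- The unitary that permutes the basis states. -/
noncomputable def permUnitary (σ : Equiv.Perm (Conf ι)) : UGroup ι :=
  ⟨(1 : Op ι).submatrix id σ, by
    rw [Matrix.mem_unitaryGroup_iff', Matrix.star_eq_conjTranspose, Matrix.conjTranspose_submatrix,
      Matrix.conjTranspose_one, ← Matrix.submatrix_mul _ _ _ id _ Function.bijective_id,
      Matrix.one_mul, Matrix.submatrix_one_equiv]⟩

/-- The basis state `u j` occurs once among the `u i` and never among the `v i`. Flipping the sign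
of this column of `U` negates the integrand but preserves the measure, so the moment equals its own
negative. -/
theorem haarMoment_eq_zero {t : ℕ} (x y u v : Fin t → Conf ι) (j : Fin t)
    (hu : ∀ i, u i = u j → i = j) (hv : ∀ i, v i ≠ u j) : haarMoment x y u v = 0 := by
  have h := haarMoment_eq_of_right_mul x y u v (signFlip (u j))
  have h2 : ∀ U : UGroup ι, ∏ i, (((U : Op ι) * (signFlip (u j) : Op ι)) (x i) (u i) *
      star (((U : Op ι) * (signFlip (u j) : Op ι)) (y i) (v i))) =
      -∏ i, ((U : Op ι) (x i) (u i) * star ((U : Op ι) (y i) (v i))) := by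
    intro U
    have h3 : ∀ i, ((U : Op ι) * (signFlip (u j) : Op ι)) (x i) (u i) *
        star (((U : Op ι) * (signFlip (u j) : Op ι)) (y i) (v i)) =
        (if i = j then -1 else 1) * ((U : Op ι) (x i) (u i) * star ((U : Op ι) (y i) (v i))) := by
      intro i
      simp only [signFlip, Matrix.mul_diagonal, if_neg (hv i)]
      by_cases hij : i = j
      · simp [hij]
      · rw [if_neg hij, if_neg fun h => hij (hu i h)]
        simp
    simp only [h3, Finset.prod_mul_distrib, Finset.prod_ite_eq', Finset.mem_univ, if_true,
      neg_mul, one_mul]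
  simp only [h2, integral_neg] at h
  exact self_eq_neg.1 h

theorem haarMoment_comp_perm {t : ℕ} (x y u v : Fin t → Conf ι) (σ : Equiv.Perm (Conf ι)) :
    haarMoment x y (σ ∘ u) (σ ∘ v) = haarMoment x y u v := by
  rw [haarMoment_eq_of_right_mul x y u v (permUnitary σ)]
  simp only [permUnitary, haarMoment]
  simp [Matrix.mul_apply, Matrix.one_apply]

theorem haarMoment_eq_of_injective {t : ℕ} (x y : Fin t → Conf ι) {u v : Fin t → Conf ι}
    (hu : Function.Injective u) (hv : Function.Injective v) :
    haarMoment x y u u = haarMoment x y v v := by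
  -- The bijection `u i ↦ v i` between the two ranges extends to a permutation of the whole finite
  -- basis.
  let e : {a // a ∈ Set.range u} ≃ {a // a ∈ Set.range v} :=
    (Equiv.ofInjective u hu).symm.trans (Equiv.ofInjective v hv)
  classical
  have h : (e.extendSubtype : Conf ι → Conf ι) ∘ u = v := by
    ext1 j
    rw [Function.comp_apply, e.extendSubtype_apply_of_mem _ ⟨j, rfl⟩]
    simp [e, Equiv.ofInjective_symm_apply]
  rw [← h, haarMoment_comp_perm]

end Haar

/-! Algebra of tensor products and relabellings -/

section TensorAlgebra

variable {ι κ : Type}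

theorem tensor_eq_submatrix_kronecker (A : Op ι) (B : Op κ) :
    tensor A B = (Matrix.kroneckerMap (· * ·) A B).submatrix
      (Equiv.sumArrowEquivProdArrow ι κ Bool) (Equiv.sumArrowEquivProdArrow ι κ Bool) := rfl

theorem tensor_add_left (A A' : Op ι) (B : Op κ) :
    tensor (A + A') B = tensor A B + tensor A' B := by
  ext x y; simp [tensor, add_mul]

theorem tensor_smul_left (c : ℂ) (A : Op ι) (B : Op κ) :
    tensor (c • A) B = c • tensor A B := by
  ext x y; simp [tensor, mul_assoc]

theorem conjTranspose_tensor (A : Op ι) (B : Op κ) :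
    (tensor A B).conjTranspose = tensor A.conjTranspose B.conjTranspose := by
  ext x y; simp [tensor]

theorem conjTranspose_relabel (e : ι ≃ κ) (A : Op ι) :
    (relabel e A).conjTranspose = relabel e A.conjTranspose := rfl

theorem relabel_eq_submatrix (e : ι ≃ κ) (A : Op ι) :
    relabel e A = A.submatrix (e.symm.arrowCongr (Equiv.refl Bool))
      (e.symm.arrowCongr (Equiv.refl Bool)) := rfl

variable [Fintype ι] [DecidableEq ι] [Fintype κ] [DecidableEq κ]

theorem tensor_mul_tensor (A A' : Op ι) (B B' : Op κ) :
    tensor A B * tensor A' B' = tensor (A * A') (B * B') := by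
  simp only [tensor_eq_submatrix_kronecker]
  rw [Matrix.submatrix_mul_equiv, ← Matrix.mul_kronecker_mul]

theorem tensor_one_one : tensor (1 : Op ι) (1 : Op κ) = 1 := by
  rw [tensor_eq_submatrix_kronecker, Matrix.kroneckerMap_one_one _ (by simp) (by simp) (by simp),
    Matrix.submatrix_one_equiv]

theorem trace_submatrix_equiv {α β : Type} [Fintype α] [Fintype β] (A : Matrix α α ℂ)
    (e : β ≃ α) : (A.submatrix e e).trace = A.trace :=
  e.sum_comp fun i => A i i

theorem trace_tensor (A : Op ι) (B : Op κ) : (tensor A B).trace = A.trace * B.trace := by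
  rw [tensor_eq_submatrix_kronecker, trace_submatrix_equiv, Matrix.trace_kronecker]

theorem posSemidef_tensor {A : Op ι} {B : Op κ} (hA : A.PosSemidef) (hB : B.PosSemidef) :
    (tensor A B).PosSemidef := by
  rw [tensor_eq_submatrix_kronecker]
  exact (hA.kronecker hB).submatrix _

theorem IsDensity.tensor {A : Op ι} {B : Op κ} (hA : IsDensity A) (hB : IsDensity B) :
    IsDensity (tensor A B) :=
  ⟨posSemidef_tensor hA.1 hB.1, by rw [trace_tensor, hA.2, hB.2, mul_one]⟩

theorem relabel_mul (e : ι ≃ κ) (A B : Op ι) : relabel e (A * B) = relabel e A * relabel e B := by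
  simp only [relabel_eq_submatrix, Matrix.submatrix_mul_equiv]

theorem relabel_one (e : ι ≃ κ) : relabel e (1 : Op ι) = 1 := by
  rw [relabel_eq_submatrix, Matrix.submatrix_one_equiv]

theorem IsDensity.relabel (e : ι ≃ κ) {A : Op ι} (hA : IsDensity A) : IsDensity (relabel e A) :=
  ⟨hA.1.submatrix _, by rw [relabel_eq_submatrix, trace_submatrix_equiv, hA.2]⟩

theorem probOne_relabel (e : ι ≃ κ) (i : ι) (A : Op ι) :
    probOne (e i) (relabel e A) = probOne i A := by
  unfold probOne relabel
  rw [← (e.arrowCongr (Equiv.refl Bool)).sum_comp]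
  refine Finset.sum_congr rfl fun x _ => ?_
  have : (e.arrowCongr (Equiv.refl Bool)) x ∘ e = x := by ext i; simp
  rw [this]
  simp

theorem posSemidef_basisState (s : Conf ι) : (basisState s).PosSemidef := by
  rw [basisState, ← Matrix.diagonal_single]
  exact Matrix.PosSemidef.diagonal fun i => by
    by_cases h : i = s
    · subst h; simp
    · simp [h]

theorem trace_basisState (s : Conf ι) : (basisState s).trace = 1 := by
  simp [basisState]

theorem posSemidef_traceLeft {ρ : Op (ι ⊕ κ)} (hρ : ρ.PosSemidef) :
    (traceLeft ρ).PosSemidef := by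
  have : traceLeft ρ = ∑ a : Conf ι, ρ.submatrix (Sum.elim a) (Sum.elim a) := by
    ext x y
    simp [traceLeft, Matrix.sum_apply]
  rw [this]
  exact Matrix.posSemidef_sum _ fun a _ => hρ.submatrix _

theorem IsDensity.traceLeft {ρ : Op (ι ⊕ κ)} (hρ : IsDensity ρ) : IsDensity (traceLeft ρ) := by
  refine ⟨posSemidef_traceLeft hρ.1, ?_⟩
  rw [← hρ.2, ← trace_submatrix_equiv ρ (Equiv.sumArrowEquivProdArrow ι κ Bool).symm]
  simp only [Matrix.trace, Matrix.diag_apply, Fintype.sum_prod_type_right, QCrypto.traceLeft,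
    Matrix.submatrix_apply]
  rfl

/-- Conjugation by an isometry maps states to states. -/
theorem isDensity_conj_of_isometry {ρ : Op ι} (hρ : IsDensity ρ)
    {K : Matrix (Conf κ) (Conf ι) ℂ} (hK : K.conjTranspose * K = 1) :
    IsDensity (K * ρ * K.conjTranspose) :=
  ⟨hρ.1.mul_mul_conjTranspose_same K, by
    rw [Matrix.trace_mul_cycle, hK, Matrix.one_mul, hρ.2]⟩

end TensorAlgebra

/-! Products over `t` registers -/

section TensorFam

variable {ι : Type} {t : ℕ}

/-- The tensor product of a family of `t` operators. -/
noncomputable def tensorFam (A : Fin t → Op ι) : Op (Fin t × ι) :=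
  fun x y => ∏ j : Fin t, A j (fun i => x (j, i)) (fun i => y (j, i))

theorem tensorPow_eq_tensorFam (A : Op ι) : tensorPow t A = tensorFam fun _ => A := rfl

theorem conjTranspose_tensorPow (A : Op ι) :
    (tensorPow t A).conjTranspose = tensorPow t A.conjTranspose := by
  ext x y; simp [tensorPow]

variable [Fintype ι] [DecidableEq ι]

theorem tensorFam_mul (A B : Fin t → Op ι) :
    tensorFam (A * B) = tensorFam A * tensorFam B := by
  ext x y
  simp only [tensorFam, Matrix.mul_apply, Pi.mul_apply]
  rw [Finset.prod_univ_sum, Fintype.piFinset_univ, ← (Equiv.curry (Fin t) ι Bool).sum_comp]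
  simp only [Finset.prod_mul_distrib]
  rfl

theorem tensorFam_one : tensorFam (1 : Fin t → Op ι) = 1 := by
  ext x y
  simp only [tensorFam, Pi.one_apply, Matrix.one_apply, Finset.prod_ite_zero,
    Finset.prod_const_one, Finset.mem_univ, true_imp_iff]
  congr 1
  simp only [funext_iff, Prod.forall]

theorem tensorPow_mul (A B : Op ι) : tensorPow t (A * B) = tensorPow t A * tensorPow t B :=
  tensorFam_mul (fun _ => A) fun _ => B

theorem tensorPow_one : tensorPow t (1 : Op ι) = 1 := tensorFam_one

theorem trace_tensorPow (A : Op ι) : (tensorPow t A).trace = A.trace ^ t := by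
  simp only [Matrix.trace, Matrix.diag_apply, tensorPow]
  rw [← Fin.prod_const, Finset.prod_univ_sum, Fintype.piFinset_univ,
    ← (Equiv.curry (Fin t) ι Bool).sum_comp]
  rfl

/-- Positivity comes from a factorization `A = B† B`, which tensor powers respect. -/
theorem IsDensity.tensorPow {A : Op ι} (hA : IsDensity A) : IsDensity (tensorPow t A) := by
  refine ⟨?_, by rw [trace_tensorPow, hA.2, one_pow]⟩
  obtain ⟨B, hB⟩ := CStarAlgebra.nonneg_iff_eq_star_mul_self.1 hA.1.nonneg
  rw [hB, Matrix.star_eq_conjTranspose, tensorPow_mul, ← conjTranspose_tensorPow]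
  exact Matrix.posSemidef_conjTranspose_mul_self _

end TensorFam

/-! Operators on subregisters and circuits -/

section Circuits

variable {ι κ μ : Type}

theorem actOn_trans_equiv (f : κ ↪ ι) (e : ι ≃ μ) (u : Op κ) :
    actOn (f.trans e.toEmbedding) u = relabel e (actOn f u) := by
  classical
  ext x y
  have : (∀ i, i ∉ Set.range (f.trans e.toEmbedding) → x i = y i) ↔
      ∀ i, i ∉ Set.range f → (x ∘ e) i = (y ∘ e) i := by
    constructor
    · intro h i hi
      refine h (e i) ?_
      rintro ⟨k, hk⟩
      exact hi ⟨k, e.injective hk⟩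
    · intro h i hi
      have h2 := h (e.symm i) fun ⟨k, hk⟩ => hi ⟨k, by simp [hk]⟩
      simpa using h2
  simp only [actOn, relabel, this]
  rfl

variable [Fintype ι] [DecidableEq ι] [Fintype κ] [DecidableEq κ] [Fintype μ] [DecidableEq μ]

theorem actOn_trans_inl (f : κ ↪ ι) (u : Op κ) :
    actOn (f.trans (Function.Embedding.inl : ι ↪ ι ⊕ μ)) u = tensor (actOn f u) (1 : Op μ) := by
  classical
  ext x y
  have : (∀ i, i ∉ Set.range (f.trans (Function.Embedding.inl : ι ↪ ι ⊕ μ)) → x i = y i) ↔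
      (∀ i, i ∉ Set.range f → (x ∘ Sum.inl) i = (y ∘ Sum.inl) i) ∧
        x ∘ Sum.inr = y ∘ Sum.inr := by
    simp [funext_iff]
  simp only [actOn, tensor, this, Matrix.one_apply, mul_ite, mul_one, mul_zero]
  by_cases h2 : x ∘ Sum.inr = y ∘ Sum.inr
  · simp only [h2, and_true, if_true]
    congr 1
  · simp [h2]

/-- The qubits of the `j`-th copy of a register. -/
def copyEmb (t : ℕ) (ι : Type) (j : Fin t) : ι ↪ Fin t × ι :=
  ⟨fun i => (j, i), fun _ _ h => (Prod.ext_iff.1 h).2⟩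

/-- Turns a query on one copy into a product operator, so that a sequence of queries can be
multiplied out factor by factor. -/
theorem actOn_copyEmb {t : ℕ} (j : Fin t) (u : Op ι) :
    actOn (copyEmb t ι j) u = tensorFam (Pi.mulSingle j u) := by
  classical
  ext x y
  have h1 : (∀ i, i ∉ Set.range (copyEmb t ι j) → x i = y i) ↔
      ∀ k ∈ Finset.univ.erase j, (fun i => x (k, i)) = fun i => y (k, i) := by
    constructor
    · intro h k hk
      ext i
      refine h (k, i) ?_
      rintro ⟨i', hi'⟩
      exact Finset.ne_of_mem_erase hk (Prod.ext_iff.1 hi').1.symm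
    · rintro h ⟨k, i⟩ hi
      refine congrFun (h k (Finset.mem_erase.2 ⟨?_, Finset.mem_univ _⟩)) i
      rintro rfl
      exact hi ⟨i, rfl⟩
  rw [tensorFam, ← Finset.mul_prod_erase _ _ (Finset.mem_univ j), Pi.mulSingle_eq_same, actOn]
  have h2 : ∀ k ∈ Finset.univ.erase j, (Pi.mulSingle j u : Fin t → Op ι) k (fun i => x (k, i))
      (fun i => y (k, i)) = if (fun i => x (k, i)) = fun i => y (k, i) then 1 else 0 := by
    intro k hk
    rw [Pi.mulSingle_eq_of_ne (Finset.ne_of_mem_erase hk), Matrix.one_apply]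
  rw [Finset.prod_congr rfl h2, Finset.prod_ite_zero, Finset.prod_const_one, mul_ite, mul_one,
    mul_zero]
  simp only [h1]
  congr 1

/-- Splitting the wires into the range of `f` and its complement reduces the algebra of `actOn` to
that of `u ⊗ 1`. -/
theorem actOn_eq_relabel_tensor (f : κ ↪ ι) (u : Op κ) [DecidablePred (· ∈ Set.range f)] :
    actOn f u = relabel (((Equiv.ofInjective f f.injective).sumCongr (Equiv.refl _)).trans
      (Equiv.Set.sumCompl (Set.range f))) (tensor u (1 : Op ((Set.range f)ᶜ : Set ι))) := by
  classical
  ext x y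
  simp only [actOn, relabel, tensor, Matrix.one_apply, mul_ite, mul_one, mul_zero]
  have h : (∀ i, i ∉ Set.range f → x i = y i) ↔
      (x ∘ (((Equiv.ofInjective f f.injective).sumCongr (Equiv.refl _)).trans
        (Equiv.Set.sumCompl (Set.range f)))) ∘ Sum.inr =
      (y ∘ (((Equiv.ofInjective f f.injective).sumCongr (Equiv.refl _)).trans
        (Equiv.Set.sumCompl (Set.range f)))) ∘ Sum.inr := by
    simp [funext_iff]
  simp only [h]
  rfl

theorem conjTranspose_actOn (f : κ ↪ ι) (u : Op κ) :
    (actOn f u).conjTranspose = actOn f u.conjTranspose := by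
  classical
  rw [actOn_eq_relabel_tensor, actOn_eq_relabel_tensor, conjTranspose_relabel,
    conjTranspose_tensor, Matrix.conjTranspose_one]

theorem actOn_mul (f : κ ↪ ι) (u v : Op κ) : actOn f (u * v) = actOn f u * actOn f v := by
  classical
  rw [actOn_eq_relabel_tensor, actOn_eq_relabel_tensor, actOn_eq_relabel_tensor, ← relabel_mul,
    tensor_mul_tensor, Matrix.one_mul]

theorem actOn_one (f : κ ↪ ι) : actOn f (1 : Op κ) = 1 := by
  classical
  rw [actOn_eq_relabel_tensor, tensor_one_one, relabel_one]

theorem Gate.conjTranspose_op_mul_op (g : Gate ι) : g.op.conjTranspose * g.op = 1 := by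
  rw [Gate.op, conjTranspose_actOn, ← actOn_mul]
  have : (g.unitary : Op (Fin g.arity)).conjTranspose * g.unitary = 1 :=
    Unitary.coe_star_mul_self g.unitary
  rw [this, actOn_one]

theorem conjTranspose_circuitOp_mul (C : List (Gate ι)) :
    (circuitOp C).conjTranspose * circuitOp C = 1 := by
  induction C with
  | nil => simp [circuitOp]
  | cons g C ih =>
    rw [circuitOp, Matrix.conjTranspose_mul, Matrix.mul_assoc,
      ← Matrix.mul_assoc (circuitOp C).conjTranspose, ih, Matrix.one_mul,
      g.conjTranspose_op_mul_op]

/-- Renaming the wires of a gate. -/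
def Gate.relabel {ι μ : Type} (e : ι ≃ μ) (g : Gate ι) : Gate μ :=
  ⟨g.arity, g.arity_le, g.wires.trans e.toEmbedding, g.unitary⟩

theorem Gate.op_relabel (e : ι ≃ μ) (g : Gate ι) :
    (g.relabel e).op = QCrypto.relabel e g.op :=
  actOn_trans_equiv _ _ _

theorem circuitOp_relabel (e : ι ≃ μ) (C : List (Gate ι)) :
    circuitOp (C.map (Gate.relabel e)) = relabel e (circuitOp C) := by
  induction C with
  | nil => exact (relabel_one e).symm
  | cons g C ih => rw [List.map_cons, circuitOp, circuitOp, ih, relabel_mul, Gate.op_relabel]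

theorem oracleCircuitOp_append {N : ℕ} (U : UGroup (Fin N)) (C D : List (Gate ι ⊕ (Fin N ↪ ι))) :
    oracleCircuitOp U (C ++ D) = oracleCircuitOp U D * oracleCircuitOp U C := by
  induction C with
  | nil => simp [oracleCircuitOp]
  | cons g C ih =>
    cases g <;> simp only [List.cons_append, oracleCircuitOp, ih, Matrix.mul_assoc]

theorem oracleCircuitOp_map_inl {N : ℕ} (U : UGroup (Fin N)) (C : List (Gate ι)) :
    oracleCircuitOp U (C.map Sum.inl) = circuitOp C := by
  induction C with
  | nil => rfl
  | cons g C ih => rw [List.map_cons, oracleCircuitOp, circuitOp, ih]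

/-- The list is reversed because its head acts first and so is the rightmost factor of the product.
-/
theorem oracleCircuitOp_copies {N t : ℕ} (U : UGroup (Fin N))
    (e : (((Fin t × Fin N) ⊕ κ) ⊕ μ) ≃ ι) (l : List (Fin t)) :
    oracleCircuitOp U (l.map fun j => Sum.inr
      ((((copyEmb t (Fin N) j).trans Function.Embedding.inl).trans
        Function.Embedding.inl).trans e.toEmbedding)) =
    relabel e (tensor (tensor (tensorFam
      (l.reverse.map fun j => (Pi.mulSingle j (U : Op (Fin N)) : Fin t → Op (Fin N))).prod)
        1) 1) := by
  induction l with
  | nil =>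
    simp only [List.reverse_nil, List.map_nil, List.prod_nil]
    rw [tensorFam_one, tensor_one_one,
      tensor_one_one, relabel_one]
    rfl
  | cons j l ih =>
    rw [List.map_cons, oracleCircuitOp, ih, actOn_trans_equiv, actOn_trans_inl, actOn_trans_inl,
      actOn_copyEmb, ← relabel_mul, tensor_mul_tensor, tensor_mul_tensor, ← tensorFam_mul,
      Matrix.one_mul, Matrix.one_mul]
    simp

theorem prod_mulSingle_apply {M : Type} [Monoid M] {t : ℕ} (u : M) (l : List (Fin t))
    (hl : l.Nodup) (i : Fin t) :
    (l.map fun j => (Pi.mulSingle j u : Fin t → M)).prod i = if i ∈ l then u else 1 := by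
  induction l with
  | nil => simp
  | cons j l ih =>
    rw [List.map_cons, List.prod_cons, Pi.mul_apply, ih hl.of_cons]
    by_cases hij : i = j
    · subst hij
      simp [(List.nodup_cons.1 hl).1]
    · simp [hij]

theorem oracleCircuitOp_all_copies {N t : ℕ} (U : UGroup (Fin N))
    (e : (((Fin t × Fin N) ⊕ κ) ⊕ μ) ≃ ι) :
    oracleCircuitOp U ((List.finRange t).map fun j => Sum.inr
      ((((copyEmb t (Fin N) j).trans Function.Embedding.inl).trans
        Function.Embedding.inl).trans e.toEmbedding)) =
    relabel e (tensor (tensor (tensorPow t (U : Op (Fin N))) 1) 1) := by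
  rw [oracleCircuitOp_copies, tensorPow_eq_tensorFam]
  congr 4
  ext1 i
  rw [prod_mulSingle_apply _ _ (List.nodup_reverse.2 (List.nodup_finRange t))]
  simp

/-! Acceptance probabilities -/

theorem probOne_nonneg (i : ι) {ρ : Op ι} (hρ : ρ.PosSemidef) : 0 ≤ probOne i ρ :=
  Finset.sum_nonneg fun x _ => by
    split_ifs
    · exact (Complex.le_def.1 hρ.diag_nonneg).1
    · exact le_rfl

theorem probOne_le_trace (i : ι) {ρ : Op ι} (hρ : ρ.PosSemidef) : probOne i ρ ≤ ρ.trace.re := by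
  rw [Matrix.trace, Complex.re_sum]
  refine Finset.sum_le_sum fun x _ => ?_
  split_ifs
  · exact le_rfl
  · exact (Complex.le_def.1 hρ.diag_nonneg).1

/-- The linear functional whose real part is the acceptance probability of an algorithm. -/
noncomputable def Distinguisher.probLM (A : Distinguisher ι) : Op ι →ₗ[ℂ] ℂ where
  toFun ρ := ∑ x, if x A.out = true then
    (circuitOp A.circuit * tensor ρ A.advice * (circuitOp A.circuit).conjTranspose) x x else 0
  map_add' ρ τ := by
    simp only [tensor_add_left, Matrix.mul_add, Matrix.add_mul, ← Finset.sum_add_distrib]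
    refine Finset.sum_congr rfl fun x _ => ?_
    split_ifs <;> simp
  map_smul' c ρ := by
    simp only [tensor_smul_left, Matrix.mul_smul, Matrix.smul_mul, smul_eq_mul, Finset.mul_sum,
      RingHom.id_apply]
    refine Finset.sum_congr rfl fun x _ => ?_
    split_ifs <;> simp

theorem Distinguisher.prob_eq_re_probLM (A : Distinguisher ι) (ρ : Op ι) :
    A.prob ρ = (A.probLM ρ).re := by
  simp only [Distinguisher.prob, probOne, probLM, LinearMap.coe_mk, AddHom.coe_mk, Complex.re_sum]
  exact Finset.sum_congr rfl fun x _ => by split_ifs <;> rfl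

theorem Distinguisher.prob_nonneg (A : Distinguisher ι) {ρ : Op ι} (hρ : ρ.PosSemidef) :
    0 ≤ A.prob ρ :=
  probOne_nonneg _ ((posSemidef_tensor hρ A.advice_isDensity.1).mul_mul_conjTranspose_same _)

theorem Distinguisher.prob_le_trace (A : Distinguisher ι) {ρ : Op ι} (hρ : ρ.PosSemidef) :
    A.prob ρ ≤ ρ.trace.re := by
  refine (probOne_le_trace _ ((posSemidef_tensor hρ
    A.advice_isDensity.1).mul_mul_conjTranspose_same _)).trans_eq ?_
  rw [Matrix.trace_mul_cycle, conjTranspose_circuitOp_mul, Matrix.one_mul, trace_tensor,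
    A.advice_isDensity.2, mul_one]

/-- The acceptance probability is linear, and on positive operators it lies between 0 and the trace.
A splitting `P - Q` therefore bounds the advantage directly, without passing through the trace norm.
-/
theorem Distinguisher.abs_prob_sub_le (A : Distinguisher ι) {ρ τ P Q : Op ι}
    (h : ρ - τ = P - Q) (hP : P.PosSemidef) (hQ : Q.PosSemidef) :
    |A.prob ρ - A.prob τ| ≤ P.trace.re + Q.trace.re := by
  have h1 : A.prob ρ - A.prob τ = A.prob P - A.prob Q := by
    rw [A.prob_eq_re_probLM, A.prob_eq_re_probLM, A.prob_eq_re_probLM, A.prob_eq_re_probLM,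
      ← Complex.sub_re, ← Complex.sub_re, ← map_sub, ← map_sub, h]
  have := A.prob_nonneg hP
  have := A.prob_nonneg hQ
  have := A.prob_le_trace hP
  have := A.prob_le_trace hQ
  rw [h1]
  exact abs_le.2 ⟨by linarith, by linarith⟩

/-- An algorithm for a renamed input register. -/
noncomputable def Distinguisher.relabel {ι μ : Type} (e : ι ≃ μ) (A : Distinguisher ι) :
    Distinguisher μ where
  work := A.work
  advice := A.advice
  advice_isDensity := A.advice_isDensity
  circuit := A.circuit.map (Gate.relabel (e.sumCongr (Equiv.refl _)))
  out := e.sumCongr (Equiv.refl _) A.out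

theorem Distinguisher.size_relabel (e : ι ≃ μ) (A : Distinguisher ι) :
    (A.relabel e).size = A.size := by
  simp [Distinguisher.size, Distinguisher.relabel, Fintype.card_congr e]

theorem Distinguisher.prob_relabel (e : ι ≃ μ) (A : Distinguisher ι) (ρ : Op ι) :
    (A.relabel e).prob (QCrypto.relabel e ρ) = A.prob ρ := by
  rw [Distinguisher.prob, Distinguisher.relabel]
  simp only [circuitOp_relabel, conjTranspose_relabel]
  have : tensor (QCrypto.relabel e ρ) A.advice =
      QCrypto.relabel (e.sumCongr (Equiv.refl _)) (tensor ρ A.advice) := rfl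
  rw [this, ← relabel_mul, ← relabel_mul, probOne_relabel, Distinguisher.prob]

end Circuits

/-! The encryption channel as a mixture of isometries -/

section Isometries

variable {ι₀ ι κ : Type} {t : ℕ}

/-- Apply `w j` to the `j`-th of the `t` parts of a basis state, and nothing to the rest. -/
def liftConf (w : Fin t → Conf ι₀ → Conf ι) (c : Conf ((Fin t × ι₀) ⊕ κ)) :
    Conf ((Fin t × ι) ⊕ κ) :=
  Sum.elim (fun p => w p.1 (fun i => c (Sum.inl (p.1, i))) p.2) (c ∘ Sum.inr)

theorem liftConf_injective {w : Fin t → Conf ι₀ → Conf ι} (hw : ∀ j, Function.Injective (w j)) :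
    Function.Injective (liftConf (κ := κ) w) := by
  intro c d h
  ext x
  rcases x with ⟨j, i⟩ | x
  · have : w j (fun i => c (Sum.inl (j, i))) = w j (fun i => d (Sum.inl (j, i))) :=
      funext fun i => congrFun h (Sum.inl (j, i))
    exact congrFun (hw j this) i
  · exact congrFun h (Sum.inr x)

/-- The basis states of `t` registers and one further register. -/
def confEquiv (t : ℕ) (ι κ : Type) :
    Conf ((Fin t × ι) ⊕ κ) ≃ (Fin t → Conf ι) × Conf κ :=
  (Equiv.sumArrowEquivProdArrow _ _ _).trans
    (Equiv.prodCongr (Equiv.curry (Fin t) ι Bool) (Equiv.refl _))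

variable [Fintype ι₀] [DecidableEq ι₀] [Fintype ι] [DecidableEq ι] [Fintype κ] [DecidableEq κ]

/-- The operator `U^{⊗t} ⊗ 1`. -/
noncomputable def copies (t : ℕ) (κ : Type) [Fintype κ] [DecidableEq κ] (U : Op ι) :
    Op ((Fin t × ι) ⊕ κ) :=
  tensor (tensorPow t U) 1

theorem copies_mul (U V : Op ι) : copies t κ (U * V) = copies t κ U * copies t κ V := by
  rw [copies, copies, copies, tensor_mul_tensor, tensorPow_mul, Matrix.one_mul]

theorem conjTranspose_copies_mul (U : UGroup ι) :
    (copies t κ (U : Op ι)).conjTranspose * copies t κ (U : Op ι) = 1 := by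
  have : (U : Op ι).conjTranspose * U = 1 := Unitary.coe_star_mul_self U
  rw [copies, conjTranspose_tensor, conjTranspose_tensorPow, tensor_mul_tensor, ← tensorPow_mul,
    this, tensorPow_one, Matrix.conjTranspose_one, Matrix.one_mul, tensor_one_one]

/-- The operator that maps basis states by `w`, and then applies `U^{⊗t} ⊗ 1`. -/
noncomputable def copiesLift (κ : Type) [Fintype κ] [DecidableEq κ]
    (w : Fin t → Conf ι₀ → Conf ι) (U : Op ι) :
    Matrix (Conf ((Fin t × ι) ⊕ κ)) (Conf ((Fin t × ι₀) ⊕ κ)) ℂ :=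
  (copies t κ U).submatrix id (liftConf w)

theorem copiesLift_mul (w : Fin t → Conf ι₀ → Conf ι) (U V : Op ι) :
    copiesLift κ w (U * V) = copies t κ U * copiesLift κ w V := by
  rw [copiesLift, copies_mul]
  rfl

theorem conjTranspose_copiesLift_mul {w : Fin t → Conf ι₀ → Conf ι}
    (hw : ∀ j, Function.Injective (w j)) (U : UGroup ι) :
    (copiesLift κ w (U : Op ι)).conjTranspose * copiesLift κ w (U : Op ι) = 1 := by
  rw [copiesLift, Matrix.conjTranspose_submatrix, ← Matrix.submatrix_mul _ _ _ id _
    Function.bijective_id, conjTranspose_copies_mul, Matrix.submatrix_one _ (liftConf_injective hw)]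

/-- The identity on `κ` pins the reference indices to those of `x` and `y`, which leaves only the
sums over the `t` copies, in the same shape as in `parallel`. -/
theorem copiesLift_conj_apply (w : Fin t → Conf ι₀ → Conf ι) (U : Op ι)
    (ρ : Op ((Fin t × ι₀) ⊕ κ)) (x y : Conf ((Fin t × ι) ⊕ κ)) :
    (copiesLift κ w U * ρ * (copiesLift κ w U).conjTranspose) x y =
      ∑ a : Fin t → Conf ι₀, ∑ b : Fin t → Conf ι₀,
        (∏ j, (U (fun i => x (Sum.inl (j, i))) (w j (a j)) *
          star (U (fun i => y (Sum.inl (j, i))) (w j (b j))))) *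
        ρ (Sum.elim (fun p => a p.1 p.2) (x ∘ Sum.inr))
          (Sum.elim (fun p => b p.1 p.2) (y ∘ Sum.inr)) := by
  have hK : ∀ (x : Conf ((Fin t × ι) ⊕ κ)) (a : Fin t → Conf ι₀) (k : Conf κ),
      copiesLift κ w U x ((confEquiv t ι₀ κ).symm (a, k)) =
        (∏ j, U (fun i => x (Sum.inl (j, i))) (w j (a j))) * if x ∘ Sum.inr = k then 1 else 0 := by
    intro x a k
    simp only [copiesLift, copies, tensor, Matrix.submatrix_apply, Matrix.one_apply, tensorPow]
    rfl
  simp only [Matrix.mul_apply, Matrix.conjTranspose_apply, ← (confEquiv t ι₀ κ).symm.sum_comp,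
    Fintype.sum_prod_type, hK, Finset.sum_mul, star_mul']
  have hρ : ∀ (a b : Fin t → Conf ι₀) (k l : Conf κ),
      ρ ((confEquiv t ι₀ κ).symm (a, k)) ((confEquiv t ι₀ κ).symm (b, l)) =
      ρ (Sum.elim (fun p => a p.1 p.2) k) (Sum.elim (fun p => b p.1 p.2) l) := fun _ _ _ _ => rfl
  simp only [hρ, apply_ite star, star_one, star_zero, mul_ite, mul_one, mul_zero, ite_mul, zero_mul]
  simp only [Finset.sum_ite_irrel, Finset.sum_const_zero, Finset.sum_ite_eq, Finset.mem_univ,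
    if_true]
  rw [Finset.sum_comm]
  refine Finset.sum_congr rfl fun a _ => Finset.sum_congr rfl fun b _ => ?_
  rw [Finset.prod_mul_distrib, star_prod]
  ring

theorem continuous_unitary_entry (x y : Conf ι) :
    Continuous fun U : UGroup ι => (U : Op ι) x y :=
  (continuous_subtype_val (p := (· ∈ Matrix.unitaryGroup (Conf ι) ℂ))).matrix_elem x y

theorem continuous_copiesLift (w : Fin t → Conf ι₀ → Conf ι) :
    Continuous fun U : UGroup ι => copiesLift κ w (U : Op ι) := by
  refine continuous_matrix fun x y => ?_
  simp only [copiesLift, copies, tensor, Matrix.submatrix_apply, tensorPow]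
  exact (continuous_finsetProd _ fun _ _ => continuous_unitary_entry _ _).mul continuous_const

/-- The Haar average of the conjugations of `ρ` by `copiesLift κ w U`. -/
noncomputable def haarTwirl (w : Fin t → Conf ι₀ → Conf ι) (ρ : Op ((Fin t × ι₀) ⊕ κ)) :
    Op ((Fin t × ι) ⊕ κ) :=
  haarMean fun U : UGroup ι => copiesLift κ w U * ρ * (copiesLift κ w U).conjTranspose

theorem isDensity_haarTwirl {w : Fin t → Conf ι₀ → Conf ι} (hw : ∀ j, Function.Injective (w j))
    {ρ : Op ((Fin t × ι₀) ⊕ κ)} (hρ : IsDensity ρ) : IsDensity (haarTwirl w ρ) := by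
  have hd : ∀ U : UGroup ι,
      IsDensity (copiesLift κ w (U : Op ι) * ρ * (copiesLift κ w (U : Op ι)).conjTranspose) :=
    fun U => isDensity_conj_of_isometry hρ (conjTranspose_copiesLift_mul hw U)
  have hc : Continuous fun U : UGroup ι => copiesLift κ w (U : Op ι) * ρ *
      (copiesLift κ w (U : Op ι)).conjTranspose := by
    have := continuous_copiesLift (κ := κ) w
    fun_prop
  refine ⟨posSemidef_haarMean hc fun U => (hd U).1, ?_⟩
  rw [haarTwirl, trace_haarMean hc]
  simp [(hd _).2]

theorem continuous_prod_entries (x y u v : Fin t → Conf ι) : Continuous fun U : UGroup ι =>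
    ∏ j, ((U : Op ι) (x j) (u j) * star ((U : Op ι) (y j) (v j))) :=
  continuous_finsetProd _ fun _ _ =>
    (continuous_unitary_entry _ _).mul (continuous_unitary_entry _ _).star

theorem haarTwirl_apply (w : Fin t → Conf ι₀ → Conf ι) (ρ : Op ((Fin t × ι₀) ⊕ κ))
    (x y : Conf ((Fin t × ι) ⊕ κ)) :
    haarTwirl w ρ x y = ∑ a : Fin t → Conf ι₀, ∑ b : Fin t → Conf ι₀,
      haarMoment (fun j i => x (Sum.inl (j, i))) (fun j i => y (Sum.inl (j, i)))
        (fun j => w j (a j)) (fun j => w j (b j)) *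
      ρ (Sum.elim (fun p => a p.1 p.2) (x ∘ Sum.inr))
        (Sum.elim (fun p => b p.1 p.2) (y ∘ Sum.inr)) := by
  simp only [haarTwirl, haarMean, copiesLift_conj_apply]
  rw [integral_finsetSum _ fun a _ => integrable_finsetSum _ fun b _ =>
    (integrable_haarU (continuous_prod_entries _ _ _ _)).mul_const _]
  refine Finset.sum_congr rfl fun a _ => ?_
  rw [integral_finsetSum _ fun b _ =>
    (integrable_haarU (continuous_prod_entries _ _ _ _)).mul_const _]
  simp only [integral_mul_const, haarMoment]

/-- If the images of the `t` maps are disjoint, the Haar twirl decouples the `t` registers from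
the rest. -/
theorem haarTwirl_apply_of_disjoint {w : Fin t → Conf ι₀ → Conf ι}
    (hw : ∀ i j a b, w i a = w j b → i = j ∧ a = b) (ρ : Op ((Fin t × ι₀) ⊕ κ))
    {u : Fin t → Conf ι} (hu : Function.Injective u) (x y : Conf ((Fin t × ι) ⊕ κ)) :
    haarTwirl w ρ x y = haarMoment (fun j i => x (Sum.inl (j, i)))
      (fun j i => y (Sum.inl (j, i))) u u * traceLeft ρ (x ∘ Sum.inr) (y ∘ Sum.inr) := by
  rw [haarTwirl_apply]
  have h1 : ∀ a : Fin t → Conf ι₀, ∀ b : Fin t → Conf ι₀, b ≠ a → haarMoment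
      (fun j i => x (Sum.inl (j, i))) (fun j i => y (Sum.inl (j, i)))
        (fun j => w j (a j)) (fun j => w j (b j)) = 0 := by
    intro a b hab
    -- At a copy `j` where `a` and `b` differ, disjointness of the images makes `w j (a j)` occur
    -- once on the left and never on the right, so the sign flip applies.
    obtain ⟨j, hj⟩ := Function.ne_iff.1 hab
    refine haarMoment_eq_zero _ _ _ _ j (fun i h => (hw _ _ _ _ h).1) fun i h => ?_
    obtain ⟨rfl, h⟩ := hw _ _ _ _ h
    exact hj h
  -- The surviving coefficients do not depend on `a`, so the sum over `a` is the partial trace.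
  have h2 : ∀ a : Fin t → Conf ι₀, haarMoment
      (fun j i => x (Sum.inl (j, i))) (fun j i => y (Sum.inl (j, i)))
        (fun j => w j (a j)) (fun j => w j (a j)) = haarMoment
      (fun j i => x (Sum.inl (j, i))) (fun j i => y (Sum.inl (j, i))) u u := fun a =>
    haarMoment_eq_of_injective _ _ (fun i j h => (hw _ _ _ _ h).1) hu
  rw [traceLeft, Finset.mul_sum, ← (Equiv.curry (Fin t) ι₀ Bool).symm.sum_comp]
  refine Finset.sum_congr rfl fun a _ => ?_
  rw [Finset.sum_eq_single a (fun b _ hb => by rw [h1 a b hb, zero_mul]) (by simp), h2]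
  rfl

/-- The Haar twirl of a product basis state, tensored with `τ`. -/
noncomputable def haarTwirlBasis (u : Fin t → Conf ι) (τ : Op κ) : Op ((Fin t × ι) ⊕ κ) :=
  haarTwirl (fun _ => id) (tensor (basisState fun p : Fin t × ι => u p.1 p.2) τ)

theorem isDensity_haarTwirlBasis (u : Fin t → Conf ι) {τ : Op κ} (hτ : IsDensity τ) :
    IsDensity (haarTwirlBasis u τ) :=
  isDensity_haarTwirl (fun _ => Function.injective_id)
    (IsDensity.tensor ⟨posSemidef_basisState _, trace_basisState _⟩ hτ)

theorem haarTwirlBasis_apply (u : Fin t → Conf ι) (τ : Op κ) (x y : Conf ((Fin t × ι) ⊕ κ)) :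
    haarTwirlBasis u τ x y = haarMoment (fun j i => x (Sum.inl (j, i)))
      (fun j i => y (Sum.inl (j, i))) u u * τ (x ∘ Sum.inr) (y ∘ Sum.inr) := by
  rw [haarTwirlBasis, haarTwirl_apply]
  have h : ∀ a b : Fin t → Conf ι,
      tensor (basisState fun p : Fin t × ι => u p.1 p.2) τ
        (Sum.elim (fun p => a p.1 p.2) (x ∘ Sum.inr))
        (Sum.elim (fun p => b p.1 p.2) (y ∘ Sum.inr)) =
      if u = a then if u = b then τ (x ∘ Sum.inr) (y ∘ Sum.inr) else 0 else 0 := by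
    intro a b
    have h3 : ∀ a : Fin t → Conf ι, ((fun p : Fin t × ι => u p.1 p.2) = fun p => a p.1 p.2) ↔
        u = a := fun a =>
      ⟨fun h => funext fun j => funext fun i => congrFun h (j, i), fun h => by rw [h]⟩
    simp only [tensor, basisState, Matrix.single_apply, Sum.elim_comp_inl, Sum.elim_comp_inr, h3,
      ite_and, ite_mul, one_mul, zero_mul]
  simp only [h, mul_ite, mul_zero]
  simp

/-- The projectors `|u⟩⟨u|` sum to the identity, which every `U^{⊗t}` fixes under conjugation. After
normalization this exhibits the maximally mixed state as an average of Haar twirls. -/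
theorem sum_haarTwirlBasis (τ : Op κ) :
    ∑ u : Fin t → Conf ι, haarTwirlBasis u τ = tensor 1 τ := by
  ext x y
  rw [Matrix.sum_apply]
  simp only [haarTwirlBasis_apply, ← Finset.sum_mul, tensor]
  congr 1
  simp only [haarMoment]
  rw [← integral_finsetSum _ fun u _ => integrable_haarU (continuous_prod_entries _ _ _ _)]
  have h : ∀ U : UGroup ι, ∑ u : Fin t → Conf ι, ∏ j,
      ((U : Op ι) (fun i => x (Sum.inl (j, i))) (u j) *
        star ((U : Op ι) (fun i => y (Sum.inl (j, i))) (u j))) =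
      tensorPow t (1 : Op ι) (x ∘ Sum.inl) (y ∘ Sum.inl) := by
    intro U
    have hU : (U : Op ι) * (U : Op ι).conjTranspose = 1 := Unitary.coe_mul_star_self U
    have h1 : tensorPow t ((U : Op ι) * (U : Op ι).conjTranspose) (x ∘ Sum.inl) (y ∘ Sum.inl) =
        ∏ j, ∑ a, (U : Op ι) (fun i => x (Sum.inl (j, i))) a *
          star ((U : Op ι) (fun i => y (Sum.inl (j, i))) a) := rfl
    rw [← hU, h1, Finset.prod_univ_sum, Fintype.piFinset_univ]
  simp only [h, tensorPow_one]
  simp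

/-- The right side does not involve `w`: all collision-free tuples of mixed qubits lead to the same
state. -/
theorem haarTwirl_eq_haarTwirlBasis {w : Fin t → Conf ι₀ → Conf ι}
    (hw : ∀ i j a b, w i a = w j b → i = j ∧ a = b) (ρ : Op ((Fin t × ι₀) ⊕ κ))
    {u : Fin t → Conf ι} (hu : Function.Injective u) :
    haarTwirl w ρ = haarTwirlBasis u (traceLeft ρ) := by
  ext x y
  rw [haarTwirl_apply_of_disjoint hw ρ hu, haarTwirlBasis_apply]

theorem haarTwirlBasis_eq_of_injective {u v : Fin t → Conf ι} (hu : Function.Injective u)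
    (hv : Function.Injective v) (τ : Op κ) : haarTwirlBasis u τ = haarTwirlBasis v τ := by
  ext x y
  rw [haarTwirlBasis_apply, haarTwirlBasis_apply, haarMoment_eq_of_injective _ _ hu hv]

end Isometries

/-! ### The padding by tag and mixed qubits, and the channel as an average over the mixed qubits -/

section Encrypt

variable {n ℓ m t : ℕ} {κ : Type} [Fintype κ] [DecidableEq κ]

/-- The basis state `|a⟩|0⟩|s⟩`. -/
def padConf (ℓ : ℕ) {n m : ℕ} (s : Conf (Fin m)) (a : Conf (Fin n)) : Conf (Fin (n + ℓ + m)) :=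
  Sum.elim (Sum.elim a fun _ : Fin ℓ => false) s ∘
    ((Equiv.sumCongr finSumFinEquiv (Equiv.refl (Fin m))).trans finSumFinEquiv).symm

theorem padConf_eq_iff (s : Conf (Fin m)) (a : Conf (Fin n)) (x : Conf (Fin (n + ℓ + m))) :
    padConf ℓ s a = x ↔
      (a = ((x ∘ ((Equiv.sumCongr finSumFinEquiv (Equiv.refl (Fin m))).trans finSumFinEquiv)) ∘
        Sum.inl) ∘ Sum.inl ∧
      (fun _ : Fin ℓ => false) = ((x ∘ ((Equiv.sumCongr finSumFinEquiv
        (Equiv.refl (Fin m))).trans finSumFinEquiv)) ∘ Sum.inl) ∘ Sum.inr) ∧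
      s = (x ∘ ((Equiv.sumCongr finSumFinEquiv (Equiv.refl (Fin m))).trans finSumFinEquiv)) ∘
        Sum.inr := by
  rw [padConf, Equiv.comp_symm_eq]
  constructor
  · intro h
    rw [← h]
    exact ⟨⟨rfl, rfl⟩, rfl⟩
  · rintro ⟨⟨h1, h2⟩, h3⟩
    ext i
    rcases i with (i | i) | i
    · exact congrFun h1 i
    · exact congrFun h2 i
    · exact congrFun h3 i

/-- Distinct values of the mixed qubits give disjoint images, which is the disjointness that the
decoupling of the twirl needs. -/
theorem padConf_injective {s s' : Conf (Fin m)} {a a' : Conf (Fin n)}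
    (h : padConf ℓ s a = padConf ℓ s' a') : s = s' ∧ a = a' := by
  have h1 := (padConf_eq_iff s a _).1 h
  have h2 := (padConf_eq_iff s' a' (padConf ℓ s' a')).1 rfl
  exact ⟨h1.2.trans h2.2.symm, h1.1.1.trans h2.1.1.symm⟩

theorem padState_single (a b : Conf (Fin n)) :
    padState ℓ m (Matrix.single a b 1) =
      ((2 : ℂ) ^ m)⁻¹ • ∑ s : Conf (Fin m), Matrix.single (padConf ℓ s a) (padConf ℓ s b) 1 := by
  ext x y
  simp only [padState, relabel, tensor, zeroState, basisState, maxMixed, Fintype.card_fin,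
    Matrix.smul_apply, Matrix.sum_apply, Matrix.single_apply, Matrix.one_apply, padConf_eq_iff,
    smul_eq_mul]
  rw [mul_left_comm]
  congr 1
  set e := (Equiv.sumCongr (finSumFinEquiv (m := n) (n := ℓ)) (Equiv.refl (Fin m))).trans
    finSumFinEquiv
  rw [Finset.sum_eq_single ((x ∘ e) ∘ Sum.inr)]
  · simp only [and_true, ← ite_and, mul_ite, mul_one, mul_zero]
    congr 1
    simp only [eq_iff_iff]
    tauto
  · intro s _ hs
    rw [if_neg]
    tauto
  · simp

theorem encrypt_single_apply (U : UGroup (Fin (n + ℓ + m))) (a b : Conf (Fin n))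
    (x y : Conf (Fin (n + ℓ + m))) :
    encrypt (n := n) (ℓ := ℓ) (m := m) U (Matrix.single a b 1) x y =
      ((2 : ℂ) ^ m)⁻¹ * ∑ s : Conf (Fin m), (U : Op (Fin (n + ℓ + m))) x (padConf ℓ s a) *
        star ((U : Op (Fin (n + ℓ + m))) y (padConf ℓ s b)) := by
  have : encrypt (n := n) (ℓ := ℓ) (m := m) U (Matrix.single a b 1) =
      (U : Op (Fin (n + ℓ + m))) * padState ℓ m (Matrix.single a b 1) *
        (U : Op (Fin (n + ℓ + m))).conjTranspose := rfl
  rw [this, padState_single, Matrix.mul_smul, Matrix.smul_mul, Matrix.smul_apply, smul_eq_mul,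
    Matrix.mul_sum, Matrix.sum_mul, Matrix.sum_apply]
  congr 1
  refine Finset.sum_congr rfl fun s _ => ?_
  simp [Matrix.mul_apply, Matrix.single_apply, ite_and]

/-- The isometry of `t` copies of the channel, for given values of the mixed qubits. -/
noncomputable def encryptIso (κ : Type) [Fintype κ] [DecidableEq κ]
    (s : Fin t → Conf (Fin m)) (U : Op (Fin (n + ℓ + m))) :
    Matrix (Conf ((Fin t × Fin (n + ℓ + m)) ⊕ κ)) (Conf ((Fin t × Fin n) ⊕ κ)) ℂ :=
  copiesLift κ (fun j => padConf ℓ (s j)) U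

/-- Each copy contributes a sum over its own mixed string; multiplying out the `t` sums gives one
sum over tuples `s`. -/
theorem parallel_encrypt (U : UGroup (Fin (n + ℓ + m))) (ρ : Op ((Fin t × Fin n) ⊕ κ)) :
    parallel t (encrypt U) ρ = (((2 : ℂ) ^ m) ^ t)⁻¹ • ∑ s : Fin t → Conf (Fin m),
      encryptIso κ s (U : Op (Fin (n + ℓ + m))) * ρ *
        (encryptIso κ s (U : Op (Fin (n + ℓ + m)))).conjTranspose := by
  ext x y
  simp only [parallel, encrypt_single_apply, Matrix.smul_apply, Matrix.sum_apply, encryptIso,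
    copiesLift_conj_apply, Finset.prod_mul_distrib (f := fun _ => ((2 : ℂ) ^ m)⁻¹), smul_eq_mul]
  rw [Finset.sum_comm, Finset.mul_sum]
  simp only [Finset.prod_const, Finset.card_univ, Fintype.card_fin, inv_pow, Finset.prod_univ_sum,
    Fintype.piFinset_univ]
  rw [← Finset.mul_sum]
  simp only [← Finset.mul_sum, mul_assoc]
  congr 1
  simp only [Finset.sum_mul]
  rw [Finset.sum_comm]
  rw [Finset.sum_congr rfl fun a _ => Finset.sum_comm, Finset.sum_comm]

theorem card_fun_conf (t m : ℕ) :
    (Fintype.card (Fin t → Conf (Fin m)) : ℂ) = ((2 : ℂ) ^ m) ^ t := by simp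

theorem isDensity_average {S α : Type} [Fintype S] [Nonempty S] [Fintype α] [DecidableEq α]
    {T : S → Op α} (hT : ∀ s, IsDensity (T s)) :
    IsDensity ((Fintype.card S : ℂ)⁻¹ • ∑ s, T s) := by
  refine ⟨(Matrix.posSemidef_sum _ fun s _ => (hT s).1).smul (by positivity), ?_⟩
  rw [Matrix.trace_smul, Matrix.trace_sum]
  simp [(hT _).2]

theorem isDensity_parallel_encrypt (U : UGroup (Fin (n + ℓ + m))) {ρ : Op ((Fin t × Fin n) ⊕ κ)}
    (hρ : IsDensity ρ) : IsDensity (parallel t (encrypt U) ρ) := by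
  rw [parallel_encrypt, ← card_fun_conf]
  exact isDensity_average fun s => isDensity_conj_of_isometry hρ
    (conjTranspose_copiesLift_mul (fun j a b h => (padConf_injective h).2) U)

/-- Allows the right factor `W` to be absorbed into an input state, on which only `U^{⊗t}` remains
to be applied. -/
theorem parallel_encrypt_mul (U W : UGroup (Fin (n + ℓ + m))) (ρ : Op ((Fin t × Fin n) ⊕ κ)) :
    parallel t (encrypt (U * W)) ρ = copies t κ (U : Op (Fin (n + ℓ + m))) *
      parallel t (encrypt W) ρ * (copies t κ (U : Op (Fin (n + ℓ + m)))).conjTranspose := by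
  simp only [parallel_encrypt, Submonoid.coe_mul, encryptIso, copiesLift_mul,
    Matrix.conjTranspose_mul, Matrix.mul_smul, Matrix.smul_mul, Matrix.mul_sum, Matrix.sum_mul,
    Matrix.mul_assoc]

theorem continuous_parallel_encrypt (ρ : Op ((Fin t × Fin n) ⊕ κ)) :
    Continuous fun U : UGroup (Fin (n + ℓ + m)) => parallel t (encrypt U) ρ := by
  have h : ∀ s : Fin t → Conf (Fin m), Continuous fun U : UGroup (Fin (n + ℓ + m)) =>
      encryptIso κ s (U : Op (Fin (n + ℓ + m))) := fun s => continuous_copiesLift _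
  simp only [parallel_encrypt]
  fun_prop

theorem haarMean_parallel_encrypt (ρ : Op ((Fin t × Fin n) ⊕ κ)) :
    haarMean (fun U : UGroup (Fin (n + ℓ + m)) => parallel t (encrypt U) ρ) =
      (Fintype.card (Fin t → Conf (Fin m)) : ℂ)⁻¹ • ∑ s : Fin t → Conf (Fin m),
        haarTwirl (fun j => padConf (n := n) ℓ (s j)) ρ := by
  ext x y
  have h : ∀ s : Fin t → Conf (Fin m), Continuous fun U : UGroup (Fin (n + ℓ + m)) =>
      encryptIso κ s (U : Op (Fin (n + ℓ + m))) := fun s => continuous_copiesLift _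
  simp only [haarMean, parallel_encrypt, Matrix.smul_apply, Matrix.sum_apply, smul_eq_mul,
    card_fun_conf]
  rw [integral_const_mul, integral_finsetSum _ fun s _ => integrable_haarU (by fun_prop)]
  rfl

theorem tensorPow_maxMixed (t z : ℕ) : tensorPow t (maxMixed (Fin z)) =
    (Fintype.card (Fin t → Conf (Fin z)) : ℂ)⁻¹ • 1 := by
  rw [card_fun_conf, ← tensorPow_one (ι := Fin z)]
  ext x y
  simp [tensorPow, maxMixed, Finset.prod_mul_distrib]

end Encrypt

/-! Comparing two averages that agree up to a few exceptional terms -/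

theorem exists_average_sub_average_eq {S R α : Type} [Fintype S] [Nonempty S] [Fintype R]
    [Nonempty R] [Fintype α] [DecidableEq α] {T : S → Op α} {W : R → Op α} {X : Op α}
    (hT : ∀ s, IsDensity (T s)) (hW : ∀ r, IsDensity (W r)) (hX : IsDensity X)
    (p : S → Prop) (r : R → Prop) [DecidablePred p] [DecidablePred r]
    (hp : ∀ s, ¬ p s → T s = X) (hr : ∀ s, ¬ r s → W s = X) :
    ∃ P Q : Op α, P.PosSemidef ∧ Q.PosSemidef ∧
      (Fintype.card S : ℂ)⁻¹ • ∑ s, T s - (Fintype.card R : ℂ)⁻¹ • ∑ s, W s = P - Q ∧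
      P.trace.re + Q.trace.re = 2 * ((Finset.univ.filter p).card / (Fintype.card S : ℝ) +
        (Finset.univ.filter r).card / (Fintype.card R : ℝ)) := by
  have key : ∀ {S : Type} [Fintype S] [Nonempty S] {T : S → Op α} (p : S → Prop)
      [DecidablePred p], (∀ s, ¬ p s → T s = X) → (Fintype.card S : ℂ)⁻¹ • ∑ s, T s =
      (Fintype.card S : ℂ)⁻¹ • ∑ s with p s, T s +
        (1 - (Finset.univ.filter p).card / (Fintype.card S : ℂ)) • X := by
    intro S _ _ T p _ hp
    have hS : (Fintype.card S : ℂ) ≠ 0 := by simp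
    have hc : ((Finset.univ.filter fun s => ¬ p s).card : ℂ) =
        Fintype.card S - (Finset.univ.filter p).card := by
      rw [eq_sub_iff_add_eq', ← Nat.cast_add, Finset.card_filter_add_card_filter_not,
        Finset.card_univ]
    rw [← Finset.sum_filter_add_sum_filter_not _ p,
      Finset.sum_congr rfl fun s hs => hp s (Finset.mem_filter.1 hs).2, Finset.sum_const,
      smul_add, ← Nat.cast_smul_eq_nsmul ℂ, smul_smul, hc]
    congr 2
    field_simp
  -- With `p` and `r` denoting the exceptional fractions, the averages contain `X` with weights `1 -
  -- p` and `1 - r`. The difference of these weights is `r - p`, so `r X` goes to `P` and `p X` to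
  -- `Q`, and each of `P` and `Q` has trace `p + r`.
  refine ⟨(Fintype.card S : ℂ)⁻¹ • ∑ s with p s, T s +
      ((Finset.univ.filter r).card / (Fintype.card R : ℂ)) • X,
    (Fintype.card R : ℂ)⁻¹ • ∑ s with r s, W s +
      ((Finset.univ.filter p).card / (Fintype.card S : ℂ)) • X, ?_, ?_, ?_, ?_⟩
  · exact ((Matrix.posSemidef_sum _ fun s _ => (hT s).1).smul (by positivity)).add
      (hX.1.smul (by positivity))
  · exact ((Matrix.posSemidef_sum _ fun s _ => (hW s).1).smul (by positivity)).add
      (hX.1.smul (by positivity))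
  · rw [key p hp, key r hr, sub_smul, sub_smul]
    abel
  · simp only [Matrix.trace_add, Matrix.trace_smul, Matrix.trace_sum, (hT _).2, (hW _).2, hX.2,
      Finset.sum_const, nsmul_eq_mul, smul_eq_mul, mul_one]
    have : ∀ a b : ℕ, ((b : ℂ)⁻¹ * a).re = a / (b : ℝ) := by
      intro a b
      rw [← Complex.ofReal_natCast, ← Complex.ofReal_natCast, ← Complex.ofReal_inv,
        ← Complex.ofReal_mul, Complex.ofReal_re, mul_comm, div_eq_mul_inv]
    simp only [Complex.add_re, this, div_eq_inv_mul]
    simp only [← div_eq_inv_mul]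
    ring

/-- A birthday bound: the union bound over ordered pairs of positions, of which there are at most
`t²`, each colliding with probability at most `1 / card α`. -/
theorem card_not_injective_le (α : Type) [Fintype α] [Nonempty α] [DecidableEq α] (t : ℕ) :
    ((Finset.univ.filter fun s : Fin t → α => ¬ Function.Injective s).card : ℝ) /
      Fintype.card (Fin t → α) ≤ (t : ℝ) ^ 2 / Fintype.card α := by
  have hα : (0 : ℝ) < Fintype.card α := by exact_mod_cast Fintype.card_pos
  have h1 : ∀ i j : Fin t, i ≠ j →
      (Finset.univ.filter fun s : Fin t → α => s i = s j).card * Fintype.card α ≤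
        Fintype.card (Fin t → α) := by
    intro i j hij
    rw [← Finset.card_univ (α := α), ← Finset.card_product]
    -- Overwriting coordinate `i` of a tuple with `s i = s j` loses nothing, since the old value can
    -- still be read off at `j`.
    refine Finset.card_le_card_of_injOn (t := Finset.univ)
      (fun q : (Fin t → α) × α => Function.update q.1 i q.2) (by simp) ?_
    rintro ⟨s, a⟩ hs ⟨s', a'⟩ hs' h
    simp only [Finset.coe_product, Finset.coe_filter, Finset.mem_univ, true_and, Finset.coe_univ,
      Set.mem_prod, Set.mem_ofPred_eq, Set.mem_univ, and_true] at hs hs' h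
    have hne : ∀ k, k ≠ i → s k = s' k := fun k hk => by
      simpa [Function.update_of_ne hk] using congrFun h k
    have h2 : a = a' := by simpa using congrFun h i
    refine Prod.ext (funext fun k => ?_) h2
    by_cases hk : k = i
    · subst hk
      exact hs.trans ((hne j (Ne.symm hij)).trans hs'.symm)
    · exact hne k hk
  have h2 : (Finset.univ.filter fun s : Fin t → α => ¬ Function.Injective s) ⊆
      (Finset.univ.filter fun q : Fin t × Fin t => q.1 ≠ q.2).biUnion fun q =>
        Finset.univ.filter fun s : Fin t → α => s q.1 = s q.2 := by
    intro s hs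
    obtain ⟨i, j, h, hij⟩ := Function.not_injective_iff.1 (Finset.mem_filter.1 hs).2
    exact Finset.mem_biUnion.2 ⟨(i, j), by simpa using hij, by simpa using h⟩
  have h3 : (Finset.univ.filter fun s : Fin t → α => ¬ Function.Injective s).card *
      Fintype.card α ≤ t ^ 2 * Fintype.card (Fin t → α) := by
    calc _ ≤ (∑ q : Fin t × Fin t with q.1 ≠ q.2,
          (Finset.univ.filter fun s : Fin t → α => s q.1 = s q.2).card) * Fintype.card α :=
          Nat.mul_le_mul_right _ ((Finset.card_le_card h2).trans Finset.card_biUnion_le)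
      _ = ∑ q : Fin t × Fin t with q.1 ≠ q.2,
          (Finset.univ.filter fun s : Fin t → α => s q.1 = s q.2).card * Fintype.card α :=
          Finset.sum_mul _ _ _
      _ ≤ ∑ q : Fin t × Fin t with q.1 ≠ q.2, Fintype.card (Fin t → α) :=
          Finset.sum_le_sum fun q hq => h1 _ _ (Finset.mem_filter.1 hq).2
      _ ≤ ∑ q : Fin t × Fin t, Fintype.card (Fin t → α) :=
          Finset.sum_le_sum_of_subset (Finset.filter_subset _ _)
      _ = _ := by simp [sq]
  have hβ : (0 : ℝ) < Fintype.card (Fin t → α) := by exact_mod_cast Fintype.card_pos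
  rw [div_le_div_iff₀ hβ hα]
  exact_mod_cast h3

/-- A splitting into positive parts serves both the trace norm bound and the bound on acceptance
probabilities. The 4 is 2 times the two collision fractions, each at most `t² / 2^m`. -/
theorem exists_haarMean_parallel_encrypt_sub {n ℓ m t : ℕ} {κ : Type} [Fintype κ] [DecidableEq κ]
    {ρ : Op ((Fin t × Fin n) ⊕ κ)} (hρ : IsDensity ρ) :
    ∃ P Q : Op ((Fin t × Fin (n + ℓ + m)) ⊕ κ), P.PosSemidef ∧ Q.PosSemidef ∧
      haarMean (fun U : UGroup (Fin (n + ℓ + m)) => parallel t (encrypt U) ρ) -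
        tensor (tensorPow t (maxMixed (Fin (n + ℓ + m)))) (traceLeft ρ) = P - Q ∧
      P.trace.re + Q.trace.re ≤ 4 * ((t : ℝ) ^ 2 / 2 ^ m) := by
  classical
  have hτ := hρ.traceLeft
  obtain ⟨X, hX, hXs, hXu⟩ : ∃ X : Op ((Fin t × Fin (n + ℓ + m)) ⊕ κ), IsDensity X ∧
      (∀ s : Fin t → Conf (Fin m), Function.Injective s →
        haarTwirl (fun j => padConf (n := n) ℓ (s j)) ρ = X) ∧
      ∀ u : Fin t → Conf (Fin (n + ℓ + m)), Function.Injective u →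
        haarTwirlBasis u (traceLeft ρ) = X := by
    have hw : ∀ s : Fin t → Conf (Fin m), Function.Injective s → ∀ i j (a b : Conf (Fin n)),
        padConf ℓ (s i) a = padConf ℓ (s j) b → i = j ∧ a = b := fun s hs i j a b h =>
      ⟨hs (padConf_injective h).1, (padConf_injective h).2⟩
    by_cases h : ∃ u : Fin t → Conf (Fin (n + ℓ + m)), Function.Injective u
    · obtain ⟨u, hu⟩ := h
      exact ⟨haarTwirlBasis u (traceLeft ρ), isDensity_haarTwirlBasis u hτ,
        fun s hs => haarTwirl_eq_haarTwirlBasis (hw s hs) ρ hu,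
        fun v hv => haarTwirlBasis_eq_of_injective hv hu _⟩
    -- Without an injective `u` there is no injective `s` either, since padding an injective `s`
    -- would give one. Both conditions on `X` are then vacuous, and any state serves.
    · refine ⟨haarTwirlBasis (fun _ _ => false) (traceLeft ρ), isDensity_haarTwirlBasis _ hτ,
        fun s hs => (h ⟨fun j => padConf ℓ (s j) fun _ => false, fun i j hij => ?_⟩).elim,
        fun u hu => (h ⟨u, hu⟩).elim⟩
      exact (hw s hs i j _ _ hij).1
  obtain ⟨P, Q, hP, hQ, hPQ, htr⟩ := exists_average_sub_average_eq
    (T := fun s : Fin t → Conf (Fin m) => haarTwirl (fun j => padConf (n := n) ℓ (s j)) ρ)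
    (W := fun u : Fin t → Conf (Fin (n + ℓ + m)) => haarTwirlBasis u (traceLeft ρ))
    (fun s => isDensity_haarTwirl (fun j a b h => (padConf_injective h).2) hρ)
    (fun u => isDensity_haarTwirlBasis u hτ) hX (fun s => ¬ Function.Injective s)
    (fun u => ¬ Function.Injective u) (fun s hs => hXs s (not_not.1 hs))
    (fun u hu => hXu u (not_not.1 hu))
  refine ⟨P, Q, hP, hQ, ?_, ?_⟩
  · rw [← hPQ, haarMean_parallel_encrypt, tensorPow_maxMixed, tensor_smul_left,
      sum_haarTwirlBasis]
  · rw [htr]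
    have h1 := card_not_injective_le (Conf (Fin m)) t
    have h2 := card_not_injective_le (Conf (Fin (n + ℓ + m))) t
    have h3 : (t : ℝ) ^ 2 / Fintype.card (Conf (Fin m)) = (t : ℝ) ^ 2 / 2 ^ m := by simp
    have h4 : (t : ℝ) ^ 2 / Fintype.card (Conf (Fin (n + ℓ + m))) ≤ (t : ℝ) ^ 2 / 2 ^ m := by
      have : (2 : ℝ) ^ m ≤ 2 ^ (n + ℓ + m) := pow_le_pow_right₀ (by norm_num) (by omega)
      simp only [Fintype.card_pi, Fintype.card_bool, Finset.prod_const, Finset.card_univ,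
        Fintype.card_fin, Nat.cast_pow, Nat.cast_ofNat]
      gcongr
    linarith

/-! Reduction to the pseudorandomness of the unitaries -/

section Reduction

variable {N t : ℕ} {κ : Type} [Fintype κ] [DecidableEq κ]

/-- The oracle algorithm which holds the state `τ` as advice, queries its oracle on each of the
`t` copies and then runs `A`. -/
noncomputable def Distinguisher.toOracle (A : Distinguisher ((Fin t × Fin N) ⊕ κ))
    (τ : Op ((Fin t × Fin N) ⊕ κ)) (hτ : IsDensity τ) : OracleDistinguisher N where
  work := Fintype.card (((Fin t × Fin N) ⊕ κ) ⊕ Fin A.work)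
  advice := QCrypto.relabel (Fintype.equivFin _) (tensor τ A.advice)
  advice_isDensity := (hτ.tensor A.advice_isDensity).relabel _
  circuit := ((List.finRange t).map fun j => Sum.inr
      ((((copyEmb t (Fin N) j).trans Function.Embedding.inl).trans
        Function.Embedding.inl).trans (Fintype.equivFin _).toEmbedding)) ++
    (A.circuit.map (Gate.relabel (Fintype.equivFin _))).map Sum.inl
  out := Fintype.equivFin _ A.out

theorem Distinguisher.size_toOracle (A : Distinguisher ((Fin t × Fin N) ⊕ κ))
    (τ : Op ((Fin t × Fin N) ⊕ κ)) (hτ : IsDensity τ) :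
    (A.toOracle τ hτ).size = A.size + t := by
  simp [OracleDistinguisher.size, Distinguisher.size, Distinguisher.toOracle]
  ring

theorem Distinguisher.prob_toOracle (A : Distinguisher ((Fin t × Fin N) ⊕ κ))
    (τ : Op ((Fin t × Fin N) ⊕ κ)) (hτ : IsDensity τ) (U : UGroup (Fin N)) :
    (A.toOracle τ hτ).prob U = A.prob (copies t κ (U : Op (Fin N)) * τ *
      (copies t κ (U : Op (Fin N))).conjTranspose) := by
  have h : tensor (copies t κ (U : Op (Fin N)) * τ *
      (copies t κ (U : Op (Fin N))).conjTranspose) A.advice =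
      tensor (copies t κ (U : Op (Fin N))) 1 * tensor τ A.advice *
        (tensor (copies t κ (U : Op (Fin N))) (1 : Op (Fin A.work))).conjTranspose := by
    rw [conjTranspose_tensor, tensor_mul_tensor, tensor_mul_tensor, Matrix.one_mul,
      Matrix.conjTranspose_one, Matrix.mul_one]
  have hC : oracleCircuitOp (ι := Fin (Fintype.card (((Fin t × Fin N) ⊕ κ) ⊕ Fin A.work))) U
      (A.toOracle τ hτ).circuit = QCrypto.relabel (Fintype.equivFin _)
        (circuitOp A.circuit * tensor (copies t κ (U : Op (Fin N))) 1) := by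
    refine (oracleCircuitOp_append U _ _).trans ?_
    rw [oracleCircuitOp_map_inl,
      circuitOp_relabel, oracleCircuitOp_all_copies, ← relabel_mul, copies]
  refine (congrArg (fun C : Op (Fin (Fintype.card (((Fin t × Fin N) ⊕ κ) ⊕ Fin A.work))) =>
    probOne (Fintype.equivFin _ A.out) (C * QCrypto.relabel (Fintype.equivFin _)
      (tensor τ A.advice) * C.conjTranspose)) hC).trans ?_
  rw [conjTranspose_relabel, ← relabel_mul, ← relabel_mul, probOne_relabel,
    Distinguisher.prob, h, Matrix.conjTranspose_mul]
  simp only [Matrix.mul_assoc]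

/-- Expanding in matrix units reduces the exchange of functional and integral to the entrywise
integrals that define `haarMean`. -/
theorem integral_linearMap_comp {ι α : Type} [Fintype ι] [DecidableEq ι] [Fintype α]
    [DecidableEq α] (L : Matrix α α ℂ →ₗ[ℂ] ℂ) {F : UGroup ι → Matrix α α ℂ}
    (hF : Continuous F) : ∫ U, L (F U) ∂haarU ι = L (haarMean F) := by
  have h : ∀ X : Matrix α α ℂ, L X = ∑ x, ∑ y, X x y * L (Matrix.single x y 1) := by
    intro X
    conv_lhs => rw [Matrix.matrix_eq_sum_single X]
    simp only [map_sum]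
    refine Finset.sum_congr rfl fun x _ => Finset.sum_congr rfl fun y _ => ?_
    rw [← smul_eq_mul, ← map_smul, Matrix.smul_single, smul_eq_mul, mul_one]
  have hc : ∀ x y, Continuous fun U => F U x y := fun x y => hF.matrix_elem x y
  rw [h (haarMean F)]
  simp only [h (F _), haarMean]
  rw [integral_finsetSum _ fun x _ => integrable_finsetSum _ fun y _ =>
    (integrable_haarU (hc x y)).mul_const _]
  refine Finset.sum_congr rfl fun x _ => ?_
  rw [integral_finsetSum _ fun y _ => (integrable_haarU (hc x y)).mul_const _]
  simp only [integral_mul_const]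

theorem continuous_linearMap_comp {ι α : Type} [Fintype ι] [DecidableEq ι] [Fintype α]
    [DecidableEq α] (L : Matrix α α ℂ →ₗ[ℂ] ℂ) {F : UGroup ι → Matrix α α ℂ}
    (hF : Continuous F) : Continuous fun U => L (F U) :=
  (LinearMap.continuous_of_finiteDimensional L).comp hF

theorem Distinguisher.integral_prob {ι α : Type} [Fintype ι] [DecidableEq ι] [Fintype α]
    [DecidableEq α] (A : Distinguisher α) {F : UGroup ι → Op α} (hF : Continuous F) :
    ∫ U, A.prob (F U) ∂haarU ι = A.prob (haarMean F) := by
  simp only [A.prob_eq_re_probLM]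
  rw [← integral_linearMap_comp A.probLM hF]
  exact integral_re (integrable_haarU (continuous_linearMap_comp A.probLM hF))

/-- The deviation of an average is at most the largest deviation of a slice. This fixes the part of
the key that does not belong to the pseudorandom family. -/
theorem exists_abs_uniformAvg_sub_le {K K' : Type} [Fintype K] [Fintype K'] [Nonempty K']
    (f : K × K' → ℝ) (c : ℝ) :
    ∃ k', |uniformAvg f - c| ≤ |uniformAvg (fun k => f (k, k')) - c| := by
  obtain ⟨k', hk'⟩ := Finite.exists_max fun k' => |uniformAvg (fun k => f (k, k')) - c|
  refine ⟨k', ?_⟩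
  have hK' : (0 : ℝ) < Fintype.card K' := by exact_mod_cast Fintype.card_pos
  have h : uniformAvg f - c = (∑ k', (uniformAvg (fun k => f (k, k')) - c)) /
      Fintype.card K' := by
    simp only [uniformAvg, Finset.sum_sub_distrib, ← Finset.sum_div, Fintype.sum_prod_type_right,
      Fintype.card_prod, Finset.sum_const, Finset.card_univ, nsmul_eq_mul, Nat.cast_mul]
    field_simp
  rw [h, abs_div, abs_of_pos hK', div_le_iff₀ hK', mul_comm, ← nsmul_eq_mul, ← Finset.card_univ]
  exact (Finset.abs_sum_le_sum_abs _ _).trans (Finset.sum_le_card_nsmul _ _ _ fun x _ => hk' x)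

end Reduction

/-! ### Asymptotic estimates and the security reduction -/

theorem negligible_sq_div_two_pow {m t : ℕ → ℕ}
    (hm : (fun n : ℕ => Real.log n) =o[Filter.atTop] fun n : ℕ => (m n : ℝ))
    (ht : PolyBounded t) : Negligible fun n => (t n : ℝ) ^ 2 / 2 ^ m n := by
  -- From `log n = o(m)` one gets `2^m ≥ n^K` eventually. In `K`, the term `c` pays for the factor
  -- `n^c`, `2 * (d + 2)` for `t² ≤ (n^(d+2))²`, and the final 1 leaves `n⁻¹`, which tends to 0.
  intro c
  obtain ⟨d, hd⟩ := ht
  set K : ℕ := c + 2 * (d + 2) + 1 with hK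
  have hK0 : (0 : ℝ) < K := by positivity
  have h2 : 0 < Real.log 2 := Real.log_pos one_lt_two
  refine squeeze_zero' (Filter.Eventually.of_forall fun n => by positivity) ?_
    (tendsto_inv_atTop_nhds_zero_nat (𝕜 := ℝ))
  filter_upwards [hm.bound (div_pos h2 hK0), Filter.eventually_ge_atTop (max d 2)] with n hn hnd
  have hn2 : 2 ≤ n := (le_max_right _ _).trans hnd
  have hnd' : d ≤ n := (le_max_left _ _).trans hnd
  have hn0 : (0 : ℝ) < n := by exact_mod_cast (by omega)
  have hpow : (n : ℝ) ^ K ≤ 2 ^ m n := by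
    rw [← Real.log_le_log_iff (by positivity) (by positivity), Real.log_pow, Real.log_pow]
    rw [Real.norm_eq_abs, Real.norm_eq_abs, Nat.abs_cast] at hn
    calc (K : ℝ) * Real.log n ≤ K * (Real.log 2 / K * m n) := by
          gcongr
          exact (le_abs_self _).trans hn
      _ = m n * Real.log 2 := by field_simp
  have htn : t n ≤ n ^ (d + 2) := by
    calc t n ≤ n ^ d + d := hd n
      _ ≤ n ^ (d + 1) + n ^ (d + 1) := by
          gcongr
          · omega
          · omega
          · exact hnd'.trans (Nat.le_self_pow (by omega) n)
      _ = 2 * n ^ (d + 1) := by ring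
      _ ≤ n * n ^ (d + 1) := by gcongr
      _ = n ^ (d + 2) := by ring
  calc (n : ℝ) ^ c * ((t n : ℝ) ^ 2 / 2 ^ m n)
      ≤ (n : ℝ) ^ c * (((n : ℝ) ^ (d + 2)) ^ 2 / (n : ℝ) ^ K) := by
        gcongr
        exact_mod_cast htn
    _ = (n : ℝ)⁻¹ := by
        rw [hK]
        field_simp
        ring

theorem PolyBounded.add {f g : ℕ → ℕ} (hf : PolyBounded f) (hg : PolyBounded g) :
    PolyBounded fun n => f n + g n := by
  obtain ⟨c, hc⟩ := hf
  obtain ⟨d, hd⟩ := hg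
  refine ⟨c + d + 2, fun n => ?_⟩
  have h := hc n
  have h' := hd n
  -- For `n < 2` the powers are at most 1 and the additive constant absorbs them; for `n ≥ 2` one
  -- extra factor `n` absorbs the sum of two powers.
  rcases Nat.lt_or_ge n 2 with hn | hn
  · have hk : ∀ k, n ^ k ≤ 1 := fun k => pow_le_one₀ (by omega) (by omega)
    have := hk c
    have := hk d
    show f n + g n ≤ _
    omega
  · have h1 : n ^ c ≤ n ^ (c + d + 1) := Nat.pow_le_pow_right (by omega) (by omega)
    have h2 : n ^ d ≤ n ^ (c + d + 1) := Nat.pow_le_pow_right (by omega) (by omega)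
    have h3 : 2 * n ^ (c + d + 1) ≤ n ^ (c + d + 2) := by
      rw [pow_succ n (c + d + 1), mul_comm]
      gcongr
    show f n + g n ≤ _
    omega

/-- A hybrid argument through the exact Haar average `H`: pseudorandomness bounds the distance from
the real scheme to `H`, and the twirl estimate that from `H` to the ideal state. The reference
register is arbitrary, so that it may also be empty. -/
theorem negligible_encrypt_of_isPRU {ℓ m κ₁ κ₂ κ₃ : ℕ → ℕ}
    {V₁ : ∀ n, Conf (Fin (κ₁ n)) → UGroup (Fin (n + ℓ n + m n))}
    (V₂ : ∀ n, Conf (Fin (κ₂ n)) → UGroup (Fin (n + ℓ n + m n)))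
    (V₃ : ∀ n, Conf (Fin (κ₃ n)) → UGroup (Fin (n + ℓ n + m n)))
    (hm : (fun n : ℕ => Real.log n) =o[Filter.atTop] fun n : ℕ => (m n : ℝ))
    (hV : IsPRU (fun n => n + ℓ n + m n) κ₁ V₁) {t : ℕ → ℕ} (ht : PolyBounded t)
    {κ : ℕ → Type} [∀ n, Fintype (κ n)] [∀ n, DecidableEq (κ n)]
    {ρ : ∀ n, Op ((Fin (t n) × Fin n) ⊕ κ n)} (hρ : ∀ n, IsDensity (ρ n))
    (A : ∀ n, Distinguisher ((Fin (t n) × Fin (n + ℓ n + m n)) ⊕ κ n))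
    (hA : PolyBounded fun n => (A n).size) :
    Negligible fun n =>
      |uniformAvg (fun k => (A n).prob
          (parallel (t n) (encrypt (scrambler (V₁ n) (V₂ n) (V₃ n) k)) (ρ n))) -
        (A n).prob (tensor (tensorPow (t n) (maxMixed (Fin (n + ℓ n + m n))))
          (traceLeft (ρ n)))| := by
  set H : ∀ n, Op ((Fin (t n) × Fin (n + ℓ n + m n)) ⊕ κ n) := fun n =>
    haarMean fun U : UGroup (Fin (n + ℓ n + m n)) => parallel (t n) (encrypt U) (ρ n) with hH
  have hmean : ∀ n, |(A n).prob (H n) - (A n).prob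
      (tensor (tensorPow (t n) (maxMixed (Fin (n + ℓ n + m n)))) (traceLeft (ρ n)))| ≤
      4 * ((t n : ℝ) ^ 2 / 2 ^ m n) := by
    intro n
    obtain ⟨P, Q, hP, hQ, hPQ, htr⟩ := exists_haarMean_parallel_encrypt_sub (ℓ := ℓ n) (m := m n)
      (hρ n)
    exact ((A n).abs_prob_sub_le hPQ hP hQ).trans htr
  choose k' hk' using fun n => exists_abs_uniformAvg_sub_le (fun k => (A n).prob
    (parallel (t n) (encrypt (scrambler (V₁ n) (V₂ n) (V₃ n) k)) (ρ n))) ((A n).prob (H n))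
  set W : ∀ n, UGroup (Fin (n + ℓ n + m n)) := fun n => V₂ n (k' n).1 * V₃ n (k' n).2 with hW
  -- The state encrypted with `W n` is advice, so preparing it costs no gates; the size of `B`
  -- exceeds that of `A` only by the `t` queries.
  set B : ∀ n, OracleDistinguisher (n + ℓ n + m n) := fun n =>
    (A n).toOracle (parallel (t n) (encrypt (W n)) (ρ n))
      (isDensity_parallel_encrypt (W n) (hρ n)) with hB
  have hBprob : ∀ n U, (B n).prob U = (A n).prob (parallel (t n) (encrypt (U * W n)) (ρ n)) := by
    intro n U
    rw [hB, Distinguisher.prob_toOracle, ← parallel_encrypt_mul]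
  have hBint : ∀ n, ∫ U, (B n).prob U ∂haarU (Fin (n + ℓ n + m n)) = (A n).prob (H n) := by
    intro n
    simp only [hBprob]
    -- For a Haar random oracle, right invariance absorbs the fixed factor `W n`.
    rw [integral_mul_right_eq_self (μ := haarU (Fin (n + ℓ n + m n)))
      (fun U => (A n).prob (parallel (t n) (encrypt U) (ρ n))) (W n)]
    exact (A n).integral_prob (continuous_parallel_encrypt (ρ n))
  have hBsize : PolyBounded fun n => (B n).size := by
    simp only [hB, Distinguisher.size_toOracle]
    exact hA.add ht
  have h1 := hV.pseudorandom B hBsize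
  have h2 : Negligible fun n => 4 * ((t n : ℝ) ^ 2 / 2 ^ m n) :=
    (negligible_sq_div_two_pow hm ht).const_mul 4
  refine (h1.add h2).trans_abs_le fun n => ?_
  rw [abs_abs]
  refine le_trans ?_ (le_abs_self _)
  refine (abs_sub_le _ ((A n).prob (H n)) _).trans (add_le_add ?_ (hmean n))
  refine (hk' n).trans_eq ?_
  beta_reduce
  rw [hBint]
  simp only [hBprob, scrambler, hW, mul_assoc]

/-! States without a reference register -/

/-- Without a reference, expanding each `Φ ρ` in matrix units and multiplying out the `t` factors
gives the double sum of `parallel`. -/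
theorem parallel_relabel_tensorPow {ι ι' : Type} [Fintype ι] [DecidableEq ι] (t : ℕ)
    (Φ : Op ι →ₗ[ℂ] Op ι') (ρ : Op ι) :
    parallel t Φ (relabel (Equiv.sumEmpty (Fin t × ι) Empty).symm (tensorPow t ρ)) =
      relabel (Equiv.sumEmpty (Fin t × ι') Empty).symm (tensorPow t (Φ ρ)) := by
  ext x y
  have h : ∀ x y, Φ ρ x y = ∑ a, ∑ b, Φ (Matrix.single a b 1) x y * ρ a b := by
    intro x y
    conv_lhs => rw [Matrix.matrix_eq_sum_single ρ]
    simp only [map_sum, Matrix.sum_apply]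
    refine Finset.sum_congr rfl fun a _ => Finset.sum_congr rfl fun b _ => ?_
    rw [← mul_one (ρ a b), ← smul_eq_mul, ← Matrix.smul_single, map_smul, Matrix.smul_apply,
      smul_eq_mul, smul_eq_mul, mul_one, mul_comm]
  simp only [parallel, relabel, tensorPow, h]
  rw [Finset.prod_univ_sum, Fintype.piFinset_univ]
  simp only [Finset.prod_univ_sum, Fintype.piFinset_univ, Finset.prod_mul_distrib]
  rfl

theorem tensor_traceLeft_relabel {ι ι' : Type} [Fintype ι] [DecidableEq ι] {ρ : Op ι}
    (hρ : ρ.trace = 1) (B : Op ι') :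
    tensor B (traceLeft (relabel (Equiv.sumEmpty ι Empty).symm ρ)) =
      relabel (Equiv.sumEmpty ι' Empty).symm B := by
  ext x y
  have : traceLeft (relabel (Equiv.sumEmpty ι Empty).symm ρ) (x ∘ Sum.inr) (y ∘ Sum.inr) = 1 := by
    rw [← hρ]
    rfl
  rw [tensor, this, mul_one]
  rfl

end QCrypto

open QCrypto
-- Both statements of the theorem
theorem theorem1 :
    (∃ C : ℝ, ∀ (n ℓ m t q : ℕ) (ρ : Op ((Fin t × Fin n) ⊕ (Fin t × Fin q))), IsDensity ρ →
      traceNorm (haarEncrypt ℓ m ρ -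
          tensor (tensorPow t (maxMixed (Fin (n + ℓ + m)))) (traceLeft ρ)) ≤
        C * ((t : ℝ) ^ 2 / 2 ^ m)) ∧
    ∀ (ℓ m κ₁ κ₂ κ₃ : ℕ → ℕ)
      (V₁ : ∀ n, Conf (Fin (κ₁ n)) → UGroup (Fin (n + ℓ n + m n)))
      (V₂ : ∀ n, Conf (Fin (κ₂ n)) → UGroup (Fin (n + ℓ n + m n)))
      (V₃ : ∀ n, Conf (Fin (κ₃ n)) → UGroup (Fin (n + ℓ n + m n)))
      (_ : (fun n : ℕ => Real.log n) =o[Filter.atTop] fun n : ℕ => (m n : ℝ))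
      (_ : IsPRU (fun n => n + ℓ n + m n) κ₁ V₁)
      (t : ℕ → ℕ) (_ : PolyBounded t),
      (∀ (q : ℕ → ℕ) (ρ : ∀ n, Op ((Fin (t n) × Fin n) ⊕ (Fin (t n) × Fin (q n)))),
        (∀ n, IsDensity (ρ n)) →
        ∀ A : ∀ n, Distinguisher ((Fin (t n) × Fin (n + ℓ n + m n)) ⊕ (Fin (t n) × Fin (q n))),
          PolyBounded (fun n => (A n).size) →
          Negligible fun n =>
            |uniformAvg (fun k => (A n).prob
                (parallel (t n) (encrypt (scrambler (V₁ n) (V₂ n) (V₃ n) k)) (ρ n))) -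
              (A n).prob (tensor (tensorPow (t n) (maxMixed (Fin (n + ℓ n + m n))))
                (traceLeft (ρ n)))|) ∧
      (∀ ρ : ∀ n, Op (Fin n), (∀ n, IsDensity (ρ n)) →
        ∀ A : ∀ n, Distinguisher (Fin (t n) × Fin (n + ℓ n + m n)),
          PolyBounded (fun n => (A n).size) →
          Negligible fun n =>
            |uniformAvg (fun k => (A n).prob
                (tensorPow (t n) (encrypt (scrambler (V₁ n) (V₂ n) (V₃ n) k) (ρ n)))) -
              (A n).prob (tensorPow (t n) (maxMixed (Fin (n + ℓ n + m n))))|) := by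
  refine ⟨⟨4, fun n ℓ m t q ρ hρ => ?_⟩, fun ℓ m κ₁ κ₂ κ₃ V₁ V₂ V₃ hm hV t ht =>
    ⟨fun q ρ hρ A hA => negligible_encrypt_of_isPRU V₂ V₃ hm hV ht hρ A hA,
      fun ρ hρ A hA => ?_⟩⟩
  · obtain ⟨P, Q, hP, hQ, hPQ, htr⟩ :=
      exists_haarMean_parallel_encrypt_sub (ℓ := ℓ) (m := m) hρ
    have h : haarEncrypt ℓ m ρ -
        tensor (tensorPow t (maxMixed (Fin (n + ℓ + m)))) (traceLeft ρ) = P - Q := hPQ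
    rw [h]
    exact (traceNorm_sub_le hP hQ).trans htr
  -- The case of product inputs is that of an empty reference register, up to the relabelling of `α
  -- ⊕ Empty` as `α`.
  · have h := negligible_encrypt_of_isPRU V₂ V₃ hm hV ht (κ := fun _ => Empty)
      (ρ := fun n => relabel (Equiv.sumEmpty (Fin (t n) × Fin n) Empty).symm
        (tensorPow (t n) (ρ n))) (fun n => (hρ n).tensorPow.relabel _)
      (fun n => (A n).relabel (Equiv.sumEmpty _ Empty).symm)
      (by simpa only [Distinguisher.size_relabel] using hA)
    simpa only [parallel_relabel_tensorPow, tensor_traceLeft_relabel (hρ _).tensorPow.2,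
      Distinguisher.prob_relabel] using h
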